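/- All $C^*$-algebras are unital, and $\otimes$ denotes their minimal tensor product. Let $N\in\mathbb N$. A closed quantum subgroup $G\subset U_N^+$ is given by a $C^*$-algebra $C(G)$ generated by the entries of a matrix $u=(u_{ij})\in M_N(C(G))$ with $u^*=u^{-1}$ and $u^t=\bar u^{-1}$, such that $\Delta(u_{ij})=\sum_k u_{ik}\otimes u_{kj}$ defines a morphism $\Delta:C(G)\to C(G)\otimes C(G)$, and such that, on the dense $*$-algebra $\mathcal A$ generated by the $u_{ij}$, $\varepsilon(u_{ij})=\delta_{ij}$ and $S(u_{ij})=u_{ji}^*$ define $*$-homomorphisms $\varepsilon:\mathcal A\to\mathbb C$ and $S:\mathcal A\to\mathcal A^{opp}$. For two such $G,H$, with coordinates $u,v$, we write $G\subset H$ when there is a morphism $C(H)\to C(G)$ with $v_{ij}\mapsto u_{ij}$. Let $C(S^{N-1}_{\mathbb C,*})$ be the universal $C^*$-algebra generated by $x_1,\dots,x_N$ with relations $\sum_i x_ix_i^*=\sum_i x_i^*x_i=1$ and the condition that all the elements $ab^*,a^*b$, with $a,b\in\{x_i\}$, commute with each other. Let $C(U_N^*)$ be the universal $C^*$-algebra generated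 by $(u_{ij})_{i,j=1,\dots,N}$ with relations $u^*=u^{-1}$, $u^t=\bar u^{-1}$ and the condition that all the elements $ab^*,a^*b$, with $a,b\in\{u_{ij}\}$, commute with each other. An affine action $G\curvearrowright X$ on a space $X$ with coordinates $x_1,\dots,x_N$ is a morphism $\Phi:C(X)\to C(G)\otimes C(X)$ with $\Phi(x_i)=\sum_j u_{ij}\otimes x_j$. The quantum isometry group of $X$ is the biggest closed quantum subgroup of $U_N^+$ acting affinely on $X$. Let $C(\mathcal PG)\subset C(G)$ be the $C^*$-subalgebra generated by all the elements $ab^*,a^*b$, with $a,b\in\{u_{ij}\}$, and let $C(\mathcal PX)\subset C(X)$ be defined in the same way from the $x_i$. A full projective action $\mathcal PG\curvearrowright\mathcal PX$ is a morphism $\Phi:C(\mathcal PX)\to C(\mathcal PG)\otimes C(\mathcal PX)$ with $$\Phi(x_ix_j^*)=\sum_{ab}u_{ia}u_{jb}^*\otimes x_ax_b^*,\qquad \Phi(x_i^*x_j)=\sum_{ab}u_{ia}^*u_{jb}\otimes x_a^*x_b .$$ Let $P^{N-1}_{\mathbb C}$ be the compact space of rank one projections $p=(p_{ij})\in M_N(\mathbb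 C)$. A full projective action $\mathcal PG\curvearrowright P^{N-1}_{\mathbb C}\times P^{N-1}_{\mathbb C}$ is defined by the same formulae on $C(P^{N-1}_{\mathbb C}\times P^{N-1}_{\mathbb C})$, with $x_ix_j^*$ replaced by the function $(p,q)\mapsto p_{ij}$ and $x_i^*x_j$ replaced by the function $(p,q)\mapsto q_{ji}$. **Proposition 4.4.** 1. $U_N^*$ is a closed quantum subgroup of $U_N^+$, and we have an affine action $U_N^*\curvearrowright S^{N-1}_{\mathbb C,*}$. 2. For every closed quantum subgroup $G\subset U_N^+$, a full projective action $\mathcal PG\curvearrowright P^{N-1}_{\mathbb C}\times P^{N-1}_{\mathbb C}$ implies $G\subset U_N^*$; likewise, a full projective action $\mathcal PG\curvearrowright\mathcal PS^{N-1}_{\mathbb C,*}$ implies $G\subset U_N^*$. 3. For every closed quantum subgroup $G\subset U_N^+$, an affine action $G\curvearrowright S^{N-1}_{\mathbb C,*}$ implies $G\subset U_N^*$. 4. $U_N^*$ is the quantum isometry group of $S^{N-1}_{\mathbb C,*}$. -/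

import Mathlib

section

open scoped TensorProduct ComplexOrder
open UniformSpace

/-- A C*-seminorm on a unital complex `*`-algebra. -/
structure CStarSeminorm (F : Type*) [Ring F] [StarRing F] [Algebra ℂ F] where
  toFun : F → ℝ
  add_le : ∀ a b, toFun (a + b) ≤ toFun a + toFun b
  smul : ∀ (c : ℂ) (a : F), toFun (c • a) = ‖c‖ * toFun a
  mul_le : ∀ a b, toFun (a * b) ≤ toFun a * toFun b
  star_mul_self : ∀ a, toFun (star a * a) = toFun a * toFun a

namespace CStarSeminorm

variable {F : Type*} [Ring F] [StarRing F] [Algebra ℂ F]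

theorem map_zero (p : CStarSeminorm F) : p.toFun 0 = 0 := by
  simpa using p.smul 0 0

theorem map_neg (p : CStarSeminorm F) (a : F) : p.toFun (-a) = p.toFun a := by
  simpa using p.smul (-1) a

theorem nonneg (p : CStarSeminorm F) (a : F) : 0 ≤ p.toFun a := by
  have h := p.add_le a (-a)
  rw [add_neg_cancel, p.map_zero, p.map_neg] at h
  linarith

theorem map_star_le (p : CStarSeminorm F) (a : F) : p.toFun a ≤ p.toFun (star a) := by
  have h := p.mul_le (star a) a
  rw [p.star_mul_self] at h
  rcases (p.nonneg a).eq_or_lt with h0 | h0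
  · rw [← h0]; exact p.nonneg _
  · exact le_of_mul_le_mul_right h h0

theorem map_star (p : CStarSeminorm F) (a : F) : p.toFun (star a) = p.toFun a :=
  le_antisymm (by simpa using p.map_star_le (star a)) (p.map_star_le a)

/-- The pointwise supremum of a pointwise bounded family of C*-seminorms. -/
noncomputable def supFamily {ι : Type*} (p : ι → CStarSeminorm F)
    (h : ∀ a, BddAbove (Set.range fun i => (p i).toFun a)) : CStarSeminorm F where
  toFun a := ⨆ i, (p i).toFun a
  add_le a b := by
    rcases isEmpty_or_nonempty ι with hι | hι
    · simp
    · exact ciSup_le fun i => ((p i).add_le a b).trans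
        (add_le_add (le_ciSup (h a) i) (le_ciSup (h b) i))
  smul c a := by
    simp only [CStarSeminorm.smul]
    exact (Real.mul_iSup_of_nonneg (norm_nonneg c) _).symm
  mul_le a b := by
    rcases isEmpty_or_nonempty ι with hι | hι
    · simp
    · exact ciSup_le fun i => ((p i).mul_le a b).trans
        (mul_le_mul (le_ciSup (h a) i) (le_ciSup (h b) i) ((p i).nonneg b)
          (Real.iSup_nonneg fun j => (p j).nonneg a))
  star_mul_self a := by
    rcases isEmpty_or_nonempty ι with hι | hι
    · simp
    · simp only [CStarSeminorm.star_mul_self]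
      have h0 : 0 ≤ ⨆ i, (p i).toFun a := Real.iSup_nonneg fun j => (p j).nonneg a
      have hb : ∀ i, (p i).toFun a * (p i).toFun a ≤
          (⨆ i, (p i).toFun a) * ⨆ i, (p i).toFun a := fun i =>
        mul_le_mul (le_ciSup (h a) i) (le_ciSup (h a) i) ((p i).nonneg a) h0
      refine le_antisymm (ciSup_le hb) ?_
      rw [← sq, ← Real.le_sqrt h0 (Real.iSup_nonneg fun j => mul_self_nonneg _)]
      refine ciSup_le fun i => Real.le_sqrt_of_sq_le ?_
      rw [sq]
      exact le_ciSup (f := fun i => (p i).toFun a * (p i).toFun a)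
        ⟨_, by rintro _ ⟨i, rfl⟩; exact hb i⟩ i

/-- The C*-seminorm `a ↦ ‖π a‖` of a unital `*`-homomorphism `π` into a C*-algebra. -/
def ofHom {B : Type*} [CStarAlgebra B] (π : F →⋆ₐ[ℂ] B) : CStarSeminorm F where
  toFun a := ‖π a‖
  add_le a b := by simpa using norm_add_le (π a) (π b)
  smul c a := by rw [_root_.map_smul, norm_smul]
  mul_le a b := by simpa using norm_mul_le (π a) (π b)
  star_mul_self a := by rw [map_mul, StarHomClass.map_star, CStarRing.norm_star_mul_self]

/-- The `*`-algebra `F`, with the topology given by the C*-seminorm `p`. -/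
def Space (_p : CStarSeminorm F) : Type _ := F

variable (p : CStarSeminorm F)

instance : Ring p.Space := inferInstanceAs (Ring F)
instance : StarRing p.Space := inferInstanceAs (StarRing F)
instance : Algebra ℂ p.Space := inferInstanceAs (Algebra ℂ F)

/-- `p` as a seminorm on the additive group underlying `F`. -/
def toAddGroupSeminorm : AddGroupSeminorm p.Space where
  toFun := p.toFun
  map_zero' := p.map_zero
  add_le' := p.add_le
  neg' := p.map_neg

noncomputable instance : SeminormedAddCommGroup p.Space :=
  p.toAddGroupSeminorm.toSeminormedAddCommGroup

noncomputable instance : SeminormedRing p.Space where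
  __ := (inferInstance : SeminormedAddCommGroup p.Space)
  __ := (inferInstance : Ring p.Space)
  norm_mul_le := p.mul_le

noncomputable instance : NormedAlgebra ℂ p.Space where
  norm_smul_le c a := (p.smul c a).le

theorem norm_star_space (a : p.Space) : ‖star a‖ = ‖a‖ := p.map_star a

theorem norm_star_mul_self_space (a : p.Space) : ‖star a * a‖ = ‖a‖ * ‖a‖ := p.star_mul_self a

theorem uniformContinuous_star_space : UniformContinuous (star : p.Space → p.Space) :=
  (AddMonoidHomClass.isometry_of_norm (starAddEquiv : p.Space ≃+ p.Space)
    p.norm_star_space).uniformContinuous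

/-- The separation and completion of `F` with respect to the C*-seminorm `p`. -/
abbrev Compl : Type _ := Completion p.Space

noncomputable instance : Star p.Compl := ⟨Completion.map star⟩

theorem coe_star (a : p.Space) : star (a : p.Compl) = ((star a : p.Space) : p.Compl) :=
  Completion.map_coe p.uniformContinuous_star_space a

theorem continuous_star : Continuous (star : p.Compl → p.Compl) := Completion.continuous_map

noncomputable instance : StarRing p.Compl where
  star_involutive x := by
    induction x using Completion.induction_on with
    | hp => exact isClosed_eq (p.continuous_star.comp p.continuous_star) continuous_id
    | ih a => rw [p.coe_star, p.coe_star, star_star]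
  star_mul x y := by
    induction x, y using Completion.induction_on₂ with
    | hp =>
      exact isClosed_eq (p.continuous_star.comp (continuous_fst.mul continuous_snd))
        ((p.continuous_star.comp continuous_snd).mul (p.continuous_star.comp continuous_fst))
    | ih a b =>
      rw [← Completion.coe_mul, p.coe_star, p.coe_star, p.coe_star, star_mul, Completion.coe_mul]
  star_add x y := by
    induction x, y using Completion.induction_on₂ with
    | hp =>
      exact isClosed_eq (p.continuous_star.comp (continuous_fst.add continuous_snd))
        ((p.continuous_star.comp continuous_fst).add (p.continuous_star.comp continuous_snd))
    | ih a b =>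
      rw [← Completion.coe_add, p.coe_star, p.coe_star, p.coe_star, star_add, Completion.coe_add]

/-- The completion of a complex `*`-algebra with respect to a C*-seminorm is a C*-algebra. -/
noncomputable instance [StarModule ℂ F] : CStarAlgebra p.Compl where
  norm_smul_le := norm_smul_le
  norm_mul_self_le x := by
    induction x using Completion.induction_on with
    | hp =>
      exact isClosed_le (continuous_norm.mul continuous_norm)
        (continuous_norm.comp (p.continuous_star.mul continuous_id))
    | ih a =>
      rw [p.coe_star, ← Completion.coe_mul, Completion.norm_coe, Completion.norm_coe,
        p.norm_star_mul_self_space]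
  star_smul c x := by
    induction x using Completion.induction_on with
    | hp =>
      exact isClosed_eq (p.continuous_star.comp (continuous_const_smul c))
        ((continuous_const_smul (star c)).comp p.continuous_star)
    | ih a =>
      rw [← Completion.coe_smul, p.coe_star, p.coe_star, ← Completion.coe_smul]
      congr 1
      exact star_smul (A := F) c a

/-- The canonical map from `F` to its completion. -/
noncomputable def toCompl [StarModule ℂ F] : F →⋆ₐ[ℂ] p.Compl where
  toFun a := ((show p.Space from a : p.Space) : p.Compl)
  map_one' := Completion.coe_one _
  map_mul' a b := Completion.coe_mul (α := p.Space) a b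
  map_zero' := Completion.coe_zero
  map_add' a b := Completion.coe_add (α := p.Space) a b
  commutes' _ := rfl
  map_star' a := (p.coe_star a).symm

theorem norm_toCompl [StarModule ℂ F] (a : F) : ‖p.toCompl a‖ = p.toFun a :=
  Completion.norm_coe (E := p.Space) a

theorem denseRange_toCompl [StarModule ℂ F] : DenseRange p.toCompl :=
  Completion.denseRange_coe (α := p.Space)

end CStarSeminorm

/-- The free unital complex `*`-algebra on generators indexed by `ι`: the free algebra on the
symbols `(i, false)`, standing for `xᵢ`, and `(i, true)`, standing for `xᵢ*`. -/
def FreeStarAlg (ι : Type*) : Type _ := FreeAlgebra ℂ (ι × Bool)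

namespace FreeStarAlg

variable {ι : Type*}

noncomputable instance : Ring (FreeStarAlg ι) := inferInstanceAs (Ring (FreeAlgebra ℂ (ι × Bool)))
noncomputable instance : Algebra ℂ (FreeStarAlg ι) :=
  inferInstanceAs (Algebra ℂ (FreeAlgebra ℂ (ι × Bool)))

/-- The symbols `xᵢ` and `xᵢ*` as elements of the free `*`-algebra. -/
noncomputable def letter (s : ι × Bool) : FreeStarAlg ι := FreeAlgebra.ι ℂ s

/-- The generator `xᵢ`. -/
noncomputable def gen (i : ι) : FreeStarAlg ι := letter (i, false)

/-- The opposite ring with the complex-conjugate scalar structure. -/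
@[reducible] noncomputable def conjOp : Algebra ℂ (FreeStarAlg ι)ᵐᵒᵖ :=
  ((algebraMap ℂ (FreeStarAlg ι)ᵐᵒᵖ).comp (starRingEnd ℂ)).toAlgebra'
    fun c x => Algebra.commutes (starRingEnd ℂ c) x

/-- The involution as a ring homomorphism to the opposite ring: conjugate-linear,
antimultiplicative, and exchanging `xᵢ` with `xᵢ*`. -/
noncomputable def starHom : FreeStarAlg ι →+* (FreeStarAlg ι)ᵐᵒᵖ :=
  letI := conjOp (ι := ι)
  (FreeAlgebra.lift ℂ (A := (FreeStarAlg ι)ᵐᵒᵖ)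
    fun s : ι × Bool => MulOpposite.op (letter (s.1, !s.2))).toRingHom

theorem starHom_letter (s : ι × Bool) :
    starHom (letter s) = MulOpposite.op (letter (s.1, !s.2)) := by
  let _ := conjOp (ι := ι)
  exact FreeAlgebra.lift_ι_apply (A := (FreeStarAlg ι)ᵐᵒᵖ)
    (fun s : ι × Bool => MulOpposite.op (letter (s.1, !s.2))) s

theorem starHom_algebraMap (c : ℂ) : starHom (algebraMap ℂ (FreeStarAlg ι) c) =
    MulOpposite.op (algebraMap ℂ (FreeStarAlg ι) (starRingEnd ℂ c)) := by
  let i := conjOp (ι := ι)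
  exact @AlgHom.commutes ℂ (FreeAlgebra ℂ (ι × Bool)) (FreeStarAlg ι)ᵐᵒᵖ _ _ _ _ i
    (FreeAlgebra.lift ℂ (A := (FreeStarAlg ι)ᵐᵒᵖ)
      fun s : ι × Bool => MulOpposite.op (letter (s.1, !s.2))) c

theorem induction {C : FreeStarAlg ι → Prop} (h1 : ∀ c, C (algebraMap ℂ (FreeStarAlg ι) c))
    (h2 : ∀ s, C (letter s)) (h3 : ∀ a b, C a → C b → C (a * b))
    (h4 : ∀ a b, C a → C b → C (a + b)) (a : FreeStarAlg ι) : C a :=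
  FreeAlgebra.induction ℂ (ι × Bool) h1 h2 h3 h4 a

noncomputable instance : StarRing (FreeStarAlg ι) where
  star a := (starHom a).unop
  star_involutive a := by
    induction a using induction with
    | h1 c => simp [starHom_algebraMap]
    | h2 s => simp [starHom_letter]
    | h3 a b ha hb => simp only [map_mul, MulOpposite.unop_mul, ha, hb]
    | h4 a b ha hb => simp only [map_add, MulOpposite.unop_add, ha, hb]
  star_mul a b := by simp
  star_add a b := by simp

theorem star_letter (s : ι × Bool) : star (letter s) = letter (s.1, !s.2) :=
  congrArg MulOpposite.unop (starHom_letter s)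

theorem star_algebraMap (c : ℂ) : star (algebraMap ℂ (FreeStarAlg ι) c) =
    algebraMap ℂ (FreeStarAlg ι) (star c) :=
  congrArg MulOpposite.unop (starHom_algebraMap c)

instance : StarModule ℂ (FreeStarAlg ι) where
  star_smul c a := by
    rw [Algebra.smul_def, star_mul, Algebra.smul_def, star_algebraMap]
    exact (Algebra.commutes _ _).symm

end FreeStarAlg

/-- The C*-seminorms on the free `*`-algebra that vanish on all the elements of `R`. -/
abbrev RelSeminorm {ι : Type*} (R : Set (FreeStarAlg ι)) : Type _ :=
  {p : CStarSeminorm (FreeStarAlg ι) // ∀ r ∈ R, p.toFun r = 0}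

/-- The relations `r = 0`, `r ∈ R`, bound the generators; this is what is needed for the universal
C*-algebra with these relations to exist. -/
def IsBoundedRel {ι : Type*} (R : Set (FreeStarAlg ι)) : Prop :=
  ∀ i, ∃ C, ∀ p : RelSeminorm R, p.1.toFun (FreeStarAlg.gen i) ≤ C

theorem IsBoundedRel.bddAbove {ι : Type*} {R : Set (FreeStarAlg ι)} (h : IsBoundedRel R)
    (a : FreeStarAlg ι) : BddAbove (Set.range fun p : RelSeminorm R => p.1.toFun a) := by
  suffices H : ∃ C, ∀ p : RelSeminorm R, p.1.toFun a ≤ C by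
    obtain ⟨C, hC⟩ := H
    exact ⟨C, by rintro _ ⟨p, rfl⟩; exact hC p⟩
  induction a using FreeStarAlg.induction with
  | h1 c =>
    refine ⟨‖c‖ * 1, fun p => ?_⟩
    rw [Algebra.algebraMap_eq_smul_one, p.1.smul]
    refine mul_le_mul_of_nonneg_left ?_ (norm_nonneg c)
    have h1 := p.1.star_mul_self 1
    rw [star_one, one_mul] at h1
    nlinarith [p.1.nonneg 1]
  | h2 s =>
    obtain ⟨i, b⟩ := s
    obtain ⟨C, hC⟩ := h i
    refine ⟨C, fun p => ?_⟩
    cases b with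
    | false => exact hC p
    | true =>
      have h2 := p.1.map_star (FreeStarAlg.gen i)
      rw [FreeStarAlg.gen, FreeStarAlg.star_letter] at h2
      exact h2.le.trans (hC p)
  | h3 a b ha hb =>
    obtain ⟨C, hC⟩ := ha
    obtain ⟨D, hD⟩ := hb
    exact ⟨C * D, fun p => (p.1.mul_le a b).trans
      (mul_le_mul (hC p) (hD p) (p.1.nonneg b) ((p.1.nonneg a).trans (hC p)))⟩
  | h4 a b ha hb =>
    obtain ⟨C, hC⟩ := ha
    obtain ⟨D, hD⟩ := hb
    exact ⟨C + D, fun p => (p.1.add_le a b).trans (add_le_add (hC p) (hD p))⟩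

/-- The largest C*-seminorm on the free `*`-algebra that vanishes on `R`. -/
noncomputable def univSeminorm {ι : Type*} (R : Set (FreeStarAlg ι)) (h : IsBoundedRel R) :
    CStarSeminorm (FreeStarAlg ι) :=
  CStarSeminorm.supFamily (fun p : RelSeminorm R => p.1) h.bddAbove

/-- The universal unital C*-algebra `C*((xᵢ) | r = 0 for r ∈ R)`. -/
abbrev UnivCStar {ι : Type*} (R : Set (FreeStarAlg ι)) (h : IsBoundedRel R) : Type _ :=
  (univSeminorm R h).Compl

/-- The generators of the universal C*-algebra. -/
noncomputable def UnivCStar.gen {ι : Type*} (R : Set (FreeStarAlg ι)) (h : IsBoundedRel R) (i : ι) :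
    UnivCStar R h :=
  (univSeminorm R h).toCompl (FreeStarAlg.gen i)

/-- In a C*-algebra, elements with `∑ xᵢ xᵢ* = 1` are contractions; so relations that contain or
imply `∑ xᵢ xᵢ* = 1` bound the generators `xᵢ`. -/
theorem RelSeminorm.le_one {ι κ : Type*} {R : Set (FreeStarAlg ι)} (s : Finset κ)
    (f : κ → FreeStarAlg ι) (hf : ∑ k ∈ s, f k * star (f k) - 1 ∈ R) (p : RelSeminorm R)
    {k : κ} (hk : k ∈ s) : p.1.toFun (f k) ≤ 1 := by
  let _ := CStarAlgebra.spectralOrder p.1.Compl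
  have _ := CStarAlgebra.spectralOrderedRing p.1.Compl
  have h1 : ∑ k ∈ s, p.1.toCompl (f k) * star (p.1.toCompl (f k)) = 1 := by
    have h0 := p.2 _ hf
    rw [← p.1.norm_toCompl, norm_eq_zero] at h0
    simpa [sub_eq_zero, StarHomClass.map_star] using h0
  have h2 : p.1.toCompl (f k) * star (p.1.toCompl (f k)) ≤ 1 := by
    rw [← h1]
    exact Finset.single_le_sum
      (f := fun k => p.1.toCompl (f k) * star (p.1.toCompl (f k)))
      (fun j _ => mul_star_self_nonneg _) hk
  have h3 := CStarAlgebra.norm_le_one_iff_of_nonneg _ (mul_star_self_nonneg (p.1.toCompl (f k)))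
    |>.2 h2
  rw [CStarRing.norm_self_mul_star, p.1.norm_toCompl] at h3
  nlinarith [p.1.nonneg (f k)]

section HilbertTensor

variable (H K : Type*) [NormedAddCommGroup H] [InnerProductSpace ℂ H]
  [NormedAddCommGroup K] [InnerProductSpace ℂ K]

/-- The Hilbert space tensor product of two Hilbert spaces. -/
abbrev HilbertTensor : Type _ := Completion (H ⊗[ℂ] K)

variable {H K}

/-- The operator `T ⊗ S` on the Hilbert space tensor product. -/
noncomputable def opTensor (T : H →L[ℂ] H) (S : K →L[ℂ] K) :
    HilbertTensor H K →L[ℂ] HilbertTensor H K :=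
  (TensorProduct.mapL T S).completion

theorem opTensor_coe (T : H →L[ℂ] H) (S : K →L[ℂ] K) (x : H ⊗[ℂ] K) :
    opTensor T S (x : HilbertTensor H K) = (TensorProduct.mapL T S x : H ⊗[ℂ] K) :=
  ContinuousLinearMap.completion_apply_coe _ x

theorem opTensor_tmul (T : H →L[ℂ] H) (S : K →L[ℂ] K) (x : H) (y : K) :
    opTensor T S ((x ⊗ₜ[ℂ] y : H ⊗[ℂ] K) : HilbertTensor H K) =
      (T x ⊗ₜ[ℂ] S y : H ⊗[ℂ] K) :=
  opTensor_coe T S _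

theorem opTensor_ext {X Y : HilbertTensor H K →L[ℂ] HilbertTensor H K}
    (h : ∀ (x : H) (y : K), X ((x ⊗ₜ[ℂ] y : H ⊗[ℂ] K)) = Y ((x ⊗ₜ[ℂ] y : H ⊗[ℂ] K))) : X = Y := by
  refine ContinuousLinearMap.ext fun z => ?_
  induction z using Completion.induction_on with
  | hp => exact isClosed_eq X.continuous Y.continuous
  | ih z =>
    induction z using TensorProduct.induction_on with
    | zero => simpa only [TensorProduct.zero_tmul] using h 0 0
    | tmul x y => exact h x y
    | add a b ha hb => rw [Completion.coe_add, map_add, map_add, ha, hb]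

theorem opTensor_mul (T T' : H →L[ℂ] H) (S S' : K →L[ℂ] K) :
    opTensor (T * T') (S * S') = opTensor T S * opTensor T' S' :=
  opTensor_ext fun x y => by simp only [opTensor_tmul, mul_apply_eq_comp]

theorem opTensor_one : opTensor (1 : H →L[ℂ] H) (1 : K →L[ℂ] K) = 1 :=
  opTensor_ext fun x y => by simp only [opTensor_tmul, one_apply_eq_self]

/-- `T ⊗ S` as a bilinear function of `T` and `S`. -/
noncomputable def opTensorBilin : (H →L[ℂ] H) →ₗ[ℂ] (K →L[ℂ] K) →ₗ[ℂ]
    (HilbertTensor H K →L[ℂ] HilbertTensor H K) :=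
  LinearMap.mk₂ ℂ opTensor
    (fun T T' S => opTensor_ext fun x y => by
      simp only [opTensor_tmul, add_apply, TensorProduct.add_tmul,
        Completion.coe_add])
    (fun c T S => opTensor_ext fun x y => by
      simp only [opTensor_tmul, smul_apply, ← TensorProduct.smul_tmul',
        Completion.coe_smul])
    (fun T S S' => opTensor_ext fun x y => by
      simp only [opTensor_tmul, add_apply, TensorProduct.tmul_add,
        Completion.coe_add])
    (fun c T S => opTensor_ext fun x y => by
      simp only [opTensor_tmul, smul_apply, TensorProduct.tmul_smul,
        Completion.coe_smul])

variable [CompleteSpace H] [CompleteSpace K]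

theorem opTensor_star (T : H →L[ℂ] H) (S : K →L[ℂ] K) :
    star (opTensor T S) = opTensor (star T) (star S) := by
  symm
  refine (ContinuousLinearMap.eq_adjoint_iff (opTensor (star T) (star S)) (opTensor T S)).2 ?_
  intro x y
  induction x, y using Completion.induction_on₂ with
  | hp => apply isClosed_eq <;> fun_prop
  | ih x y =>
    rw [opTensor_coe, opTensor_coe, Completion.inner_coe, Completion.inner_coe]
    induction x using TensorProduct.induction_on with
    | zero => simp
    | add a b ha hb => simp only [map_add, inner_add_left, ha, hb]
    | tmul a b =>
      induction y using TensorProduct.induction_on with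
      | zero => simp
      | add a b ha hb => simp only [map_add, inner_add_right, ha, hb]
      | tmul c d =>
        simp [-TensorProduct.mapL_apply, TensorProduct.mapL_tmul,
          ContinuousLinearMap.star_eq_adjoint, ContinuousLinearMap.adjoint_inner_left]

variable {A B : Type*} [CStarAlgebra A] [CStarAlgebra B]

/-- The linear map `a ⊗ b ↦ π a ⊗ ρ b`. -/
noncomputable def repTensorLin (π : A →⋆ₐ[ℂ] (H →L[ℂ] H)) (ρ : B →⋆ₐ[ℂ] (K →L[ℂ] K)) :
    A ⊗[ℂ] B →ₗ[ℂ] (HilbertTensor H K →L[ℂ] HilbertTensor H K) :=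
  TensorProduct.lift (opTensorBilin.compl₁₂ π.toAlgHom.toLinearMap ρ.toAlgHom.toLinearMap)

theorem repTensorLin_tmul (π : A →⋆ₐ[ℂ] (H →L[ℂ] H)) (ρ : B →⋆ₐ[ℂ] (K →L[ℂ] K)) (a : A) (b : B) :
    repTensorLin π ρ (a ⊗ₜ b) = opTensor (π a) (ρ b) := rfl

/-- The tensor product of two representations, `a ⊗ b ↦ π a ⊗ ρ b`. -/
noncomputable def repTensor (π : A →⋆ₐ[ℂ] (H →L[ℂ] H)) (ρ : B →⋆ₐ[ℂ] (K →L[ℂ] K)) :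
    A ⊗[ℂ] B →⋆ₐ[ℂ] (HilbertTensor H K →L[ℂ] HilbertTensor H K) where
  toAlgHom := Algebra.TensorProduct.algHomOfLinearMapTensorProduct (repTensorLin π ρ)
    (fun a a' b b' => by
      simp only [repTensorLin_tmul, map_mul]
      exact opTensor_mul _ _ _ _)
    (by rw [repTensorLin_tmul, map_one, map_one, opTensor_one])
  map_star' t := by
    change repTensorLin π ρ (star t) = star (repTensorLin π ρ t)
    induction t using TensorProduct.induction_on with
    | zero =>
      rw [star_zero, LinearMap.map_zero]
      exact (star_zero (HilbertTensor H K →L[ℂ] HilbertTensor H K)).symm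
    | tmul a b =>
      rw [TensorProduct.star_tmul, repTensorLin_tmul, repTensorLin_tmul, opTensor_star,
        StarHomClass.map_star, StarHomClass.map_star]
    | add s t hs ht =>
      rw [star_add, LinearMap.map_add, LinearMap.map_add, hs, ht]
      exact (star_add (R := HilbertTensor H K →L[ℂ] HilbertTensor H K) _ _).symm

theorem repTensor_tmul (π : A →⋆ₐ[ℂ] (H →L[ℂ] H)) (ρ : B →⋆ₐ[ℂ] (K →L[ℂ] K)) (a : A) (b : B) :
    repTensor π ρ (a ⊗ₜ b) = opTensor (π a) (ρ b) := rfl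

end HilbertTensor

section MinTensor

/-- The positive linear functionals on a C*-algebra. -/
abbrev PosFunctional (A : Type*) [CStarAlgebra A] : Type _ :=
  letI := CStarAlgebra.spectralOrder A
  A →ₚ[ℂ] ℂ

variable {A B : Type*} [CStarAlgebra A] [CStarAlgebra B]

/-- The Hilbert space of the GNS representation of a positive functional. -/
abbrev GNSSpace (φ : PosFunctional A) : Type _ :=
  letI := CStarAlgebra.spectralOrder A
  haveI := CStarAlgebra.spectralOrderedRing A
  PositiveLinearMap.GNS φ

/-- The GNS representation of a positive functional. -/
noncomputable def gnsRep (φ : PosFunctional A) : A →⋆ₐ[ℂ] (GNSSpace φ →L[ℂ] GNSSpace φ) :=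
  letI := CStarAlgebra.spectralOrder A
  haveI := CStarAlgebra.spectralOrderedRing A
  PositiveLinearMap.gnsStarAlgHom φ

variable (A B) in
/-- The C*-seminorms `t ↦ ‖(π_φ ⊗ π_ψ) t‖` on the algebraic tensor product of two C*-algebras, with
`φ` and `ψ` running over the positive functionals. -/
noncomputable def gnsTensorSeminorm (s : PosFunctional A × PosFunctional B) :
    CStarSeminorm (A ⊗[ℂ] B) :=
  CStarSeminorm.ofHom (B := HilbertTensor (GNSSpace s.1) (GNSSpace s.2) →L[ℂ]
    HilbertTensor (GNSSpace s.1) (GNSSpace s.2)) (repTensor (gnsRep s.1) (gnsRep s.2))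

theorem gnsTensorSeminorm_bddAbove (t : A ⊗[ℂ] B) :
    BddAbove (Set.range fun s => (gnsTensorSeminorm A B s).toFun t) := by
  suffices H : ∃ C, ∀ s, (gnsTensorSeminorm A B s).toFun t ≤ C by
    obtain ⟨C, hC⟩ := H
    exact ⟨C, by rintro _ ⟨s, rfl⟩; exact hC s⟩
  induction t using TensorProduct.induction_on with
  | zero => exact ⟨0, fun s => (CStarSeminorm.map_zero _).le⟩
  | add a b ha hb =>
    obtain ⟨C, hC⟩ := ha
    obtain ⟨D, hD⟩ := hb
    exact ⟨C + D, fun s => (CStarSeminorm.add_le _ a b).trans (add_le_add (hC s) (hD s))⟩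
  | tmul a b =>
    refine ⟨‖a‖ * ‖b‖, fun s => ?_⟩
    change ‖repTensor (gnsRep s.1) (gnsRep s.2) (a ⊗ₜ b)‖ ≤ _
    rw [repTensor_tmul]
    have h1 : ‖opTensor (gnsRep s.1 a) (gnsRep s.2 b)‖ ≤ ‖gnsRep s.1 a‖ * ‖gnsRep s.2 b‖ := by
      refine ContinuousLinearMap.opNorm_le_bound _ (by positivity) fun x => ?_
      induction x using Completion.induction_on with
      | hp => apply isClosed_le <;> fun_prop
      | ih x =>
        rw [opTensor, ContinuousLinearMap.completion_apply_coe, Completion.norm_coe,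
          Completion.norm_coe]
        exact (ContinuousLinearMap.le_opNorm _ _).trans
          (mul_le_mul_of_nonneg_right (TensorProduct.norm_mapL_le _ _) (norm_nonneg _))
    exact h1.trans (mul_le_mul (NonUnitalStarAlgHom.norm_apply_le _ _)
      (NonUnitalStarAlgHom.norm_apply_le _ _) (norm_nonneg _) (norm_nonneg _))

variable (A B) in
/-- The minimal (spatial) C*-norm on the algebraic tensor product of two C*-algebras: the operator
norm in the tensor product of the universal representations. -/
noncomputable def minSeminorm : CStarSeminorm (A ⊗[ℂ] B) :=
  CStarSeminorm.supFamily (gnsTensorSeminorm A B) gnsTensorSeminorm_bddAbove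

variable (A B) in
/-- The minimal tensor product of two C*-algebras. -/
abbrev MinTensor : Type _ := (minSeminorm A B).Compl

/-- The elementary tensor `a ⊗ b` in the minimal tensor product. -/
noncomputable def MinTensor.tmul (a : A) (b : B) : MinTensor A B :=
  (minSeminorm A B).toCompl (a ⊗ₜ b)

end MinTensor

section Coordinates

variable {ι A : Type*} [CStarAlgebra A]

/-- The elements `a b*` and `a* b`, with `a, b` among the coordinates `xᵢ`. -/
def projCoords {ι A : Type*} [Mul A] [Star A] (x : ι → A) : Set A :=
  {y | ∃ i j, y = x i * star (x j) ∨ y = star (x i) * x j}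

/-- The `*`-algebra of polynomials in the coordinates `xᵢ`. -/
def polyAlg (x : ι → A) : StarSubalgebra ℂ A := StarAlgebra.adjoin ℂ (Set.range x)

/-- The algebra of functions on the full projective version: the C*-subalgebra generated by all
the elements `xᵢ xⱼ*` and `xᵢ* xⱼ`. -/
def projAlg (x : ι → A) : StarSubalgebra ℂ A :=
  (StarAlgebra.adjoin ℂ (projCoords x)).topologicalClosure

instance (x : ι → A) : IsClosed (projAlg x : Set A) :=
  StarSubalgebra.isClosed_topologicalClosure _

theorem coord_mem_polyAlg (x : ι → A) (i : ι) : x i ∈ polyAlg x :=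
  StarAlgebra.subset_adjoin ℂ _ ⟨i, rfl⟩

theorem projCoords_subset (x : ι → A) : projCoords x ⊆ projAlg x :=
  (StarAlgebra.subset_adjoin ℂ _).trans (StarSubalgebra.le_topologicalClosure _)

/-- `xᵢ` as an element of the polynomial `*`-algebra. -/
def polyCoord (x : ι → A) (i : ι) : polyAlg x := ⟨x i, coord_mem_polyAlg x i⟩

/-- `xᵢ xⱼ*` as an element of the algebra of the full projective version. -/
def projMulStar (x : ι → A) (i j : ι) : projAlg x :=
  ⟨x i * star (x j), projCoords_subset x ⟨i, j, Or.inl rfl⟩⟩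

/-- `xᵢ* xⱼ` as an element of the algebra of the full projective version. -/
def projStarMul (x : ι → A) (i j : ι) : projAlg x :=
  ⟨star (x i) * x j, projCoords_subset x ⟨i, j, Or.inr rfl⟩⟩

end Coordinates

/-- The coordinates of a matrix, as a family indexed by pairs. -/
def entries {N : ℕ} {A : Type*} (u : Matrix (Fin N) (Fin N) A) : Fin N × Fin N → A :=
  fun k => u k.1 k.2

/-- `(A, u)` is `(C(G), (uᵢⱼ))` for a closed quantum subgroup `G ⊂ U_N⁺`: the matrix `u` and its
transpose are unitary, the entries of `u` generate the C*-algebra `A`, there is a comultiplication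
`A → A ⊗ A` with `Δ(uᵢⱼ) = ∑ₖ uᵢₖ ⊗ uₖⱼ`, and on the dense `*`-algebra of polynomials in the `uᵢⱼ`
there are a counit with `ε(uᵢⱼ) = δᵢⱼ` and an antipode (a `*`-homomorphism to the opposite algebra)
with `S(uᵢⱼ) = uⱼᵢ*`. Both the full and the reduced versions of `C(G)` are allowed. -/
structure IsClosedSubgroup {N : ℕ} {A : Type*} [CStarAlgebra A]
    (u : Matrix (Fin N) (Fin N) A) : Prop where
  mul_star : u * u.conjTranspose = 1
  star_mul : u.conjTranspose * u = 1
  transpose_mul : u.transpose * u.map star = 1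
  mul_transpose : u.map star * u.transpose = 1
  dense : (polyAlg (entries u)).topologicalClosure = ⊤
  comul : ∃ Δ : A →⋆ₐ[ℂ] MinTensor A A, ∀ i j, Δ (u i j) = ∑ k, MinTensor.tmul (u i k) (u k j)
  counit : ∃ ε : polyAlg (entries u) →⋆ₐ[ℂ] ℂ,
    ∀ i j, ε (polyCoord (entries u) (i, j)) = if i = j then 1 else 0
  antipode : ∃ S : polyAlg (entries u) →⋆ₐ[ℂ] (polyAlg (entries u))ᵐᵒᵖ,
    ∀ i j, S (polyCoord (entries u) (i, j)) =
      MulOpposite.op (star (polyCoord (entries u) (j, i)))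

/-- The inclusion `G ⊂ H` of quantum subgroups of `U_N⁺`, where `C(G)` and `C(H)` have standard
coordinates `u` and `v`: there is a morphism `C(H) → C(G)` mapping coordinates to coordinates. -/
def QIncl {N : ℕ} {A B : Type*} [CStarAlgebra A] [CStarAlgebra B]
    (u : Matrix (Fin N) (Fin N) A) (v : Matrix (Fin N) (Fin N) B) : Prop :=
  ∃ π : B →⋆ₐ[ℂ] A, ∀ i j, π (v i j) = u i j

/-- The affine action `G ↷ X`: the formula `Φ(xᵢ) = ∑ⱼ uᵢⱼ ⊗ xⱼ` defines a morphism of C*-algebras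
`Φ : C(X) → C(G) ⊗ C(X)`. -/
def AffineAction {N : ℕ} {A B : Type*} [CStarAlgebra A] [CStarAlgebra B]
    (u : Matrix (Fin N) (Fin N) A) (x : Fin N → B) : Prop :=
  ∃ Φ : B →⋆ₐ[ℂ] MinTensor A B, ∀ i, Φ (x i) = ∑ j, MinTensor.tmul (u i j) (x j)

/-- The full projective action of `G` on a space with algebra of functions `B`, generated by
coordinates `pᵢⱼ` and `qᵢⱼ` which play the role of `xᵢ xⱼ*` and `xᵢ* xⱼ`: the formulae
`Φ(pᵢⱼ) = ∑ uᵢₐ uⱼᵦ* ⊗ pₐᵦ` and `Φ(qᵢⱼ) = ∑ uᵢₐ* uⱼᵦ ⊗ qₐᵦ` define a morphism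
`Φ : B → C(𝒫G) ⊗ B`. -/
def FullProjAction {N : ℕ} {A B : Type*} [CStarAlgebra A] [CStarAlgebra B]
    (u : Matrix (Fin N) (Fin N) A) (p q : Fin N → Fin N → B) : Prop :=
  ∃ Φ : B →⋆ₐ[ℂ] MinTensor (projAlg (entries u)) B,
    (∀ i j, Φ (p i j) = ∑ a, ∑ b,
      MinTensor.tmul (projMulStar (entries u) (i, a) (j, b)) (p a b)) ∧
    (∀ i j, Φ (q i j) = ∑ a, ∑ b,
      MinTensor.tmul (projStarMul (entries u) (i, a) (j, b)) (q a b))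

/-- `H`, with coordinates `v`, is the quantum isometry group of `X`, with coordinates `x`: the
biggest closed quantum subgroup of `U_N⁺` that acts affinely on `X`. -/
def IsQuantumIsometryGroup.{w, v₁, v₂} {N : ℕ} {C : Type v₁} {B : Type v₂} [CStarAlgebra C]
    [CStarAlgebra B] (v : Matrix (Fin N) (Fin N) C) (x : Fin N → B) : Prop :=
  IsClosedSubgroup v ∧ AffineAction v x ∧
    ∀ (A : Type w) [CStarAlgebra A] (u : Matrix (Fin N) (Fin N) A),
      IsClosedSubgroup u → AffineAction u x → QIncl u v

section HalfClassical

/-- The relations saying that all the elements `ab*`, `a*b`, with `a, b ∈ {xᵢ}`, commute. -/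
def halfClassicalRel {ι F : Type*} [Ring F] [Star F] (x : ι → F) : Set F :=
  {r | ∃ y ∈ projCoords x, ∃ z ∈ projCoords x, r = y * z - z * y}

/-- The relations of `S^{N-1}_{ℂ,*}`: `∑ xᵢ xᵢ* = ∑ xᵢ* xᵢ = 1`, and all the `ab*`, `a*b`
commute. -/
def sphereRel (N : ℕ) : Set (FreeStarAlg (Fin N)) :=
  {∑ i, FreeStarAlg.gen i * star (FreeStarAlg.gen i) - 1,
    ∑ i, star (FreeStarAlg.gen i) * FreeStarAlg.gen i - 1} ∪ halfClassicalRel FreeStarAlg.gen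

theorem sphereRel_bounded (N : ℕ) : IsBoundedRel (sphereRel N) := fun i =>
  ⟨1, fun p => RelSeminorm.le_one Finset.univ FreeStarAlg.gen (Or.inl (Or.inl rfl)) p
    (Finset.mem_univ i)⟩

/-- The C*-algebra `C(S^{N-1}_{ℂ,*})`. -/
abbrev HalfSphere (N : ℕ) : Type := UnivCStar (sphereRel N) (sphereRel_bounded N)

/-- The standard coordinates of `S^{N-1}_{ℂ,*}`. -/
noncomputable def sphereCoord (N : ℕ) : Fin N → HalfSphere N :=
  UnivCStar.gen (sphereRel N) (sphereRel_bounded N)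

/-- The matrix of generators of the free `*`-algebra on `N²` generators. -/
noncomputable def freeMatrix (N : ℕ) : Matrix (Fin N) (Fin N) (FreeStarAlg (Fin N × Fin N)) :=
  fun i j => FreeStarAlg.gen (i, j)

/-- The relations of `U_N*`: `u* = u⁻¹`, `uᵗ = ū⁻¹`, and all the `ab*`, `a*b`, with
`a, b ∈ {uᵢⱼ}`, commute. -/
def unitaryRel (N : ℕ) : Set (FreeStarAlg (Fin N × Fin N)) :=
  {r | ∃ i j, r = (freeMatrix N * (freeMatrix N).conjTranspose - 1) i j ∨
      r = ((freeMatrix N).conjTranspose * freeMatrix N - 1) i j ∨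
      r = ((freeMatrix N).transpose * (freeMatrix N).map star - 1) i j ∨
      r = ((freeMatrix N).map star * (freeMatrix N).transpose - 1) i j} ∪
    halfClassicalRel FreeStarAlg.gen

theorem unitaryRel_bounded (N : ℕ) : IsBoundedRel (unitaryRel N) := fun k =>
  ⟨1, fun p => RelSeminorm.le_one Finset.univ (fun j => FreeStarAlg.gen (k.1, j))
    (Or.inl ⟨k.1, k.1, Or.inl (by simp [Matrix.mul_apply, freeMatrix])⟩) p (Finset.mem_univ k.2)⟩

/-- The C*-algebra `C(U_N*)`. -/
abbrev HalfUnitary (N : ℕ) : Type := UnivCStar (unitaryRel N) (unitaryRel_bounded N)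

/-- The standard coordinates of `U_N*`. -/
noncomputable def unitaryCoord (N : ℕ) : Matrix (Fin N) (Fin N) (HalfUnitary N) :=
  fun i j => UnivCStar.gen (unitaryRel N) (unitaryRel_bounded N) (i, j)

/-- The complex projective space, as the space of rank one projections in `M_N(ℂ)`. -/
def ProjSpace (N : ℕ) : Type :=
  {p : Matrix (Fin N) (Fin N) ℂ // p * p = p ∧ p.conjTranspose = p ∧ p.trace = 1}

noncomputable instance (N : ℕ) : TopologicalSpace (ProjSpace N) :=
  instTopologicalSpaceSubtype

theorem projSpace_norm_le {N : ℕ} {p : Matrix (Fin N) (Fin N) ℂ} (h1 : p * p = p)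
    (h2 : p.conjTranspose = p) (h3 : p.trace = 1) (i j : Fin N) : ‖p i j‖ ≤ 1 := by
  have hrow : ∀ k, (p k k).re = ∑ l, ‖p k l‖ ^ 2 := by
    intro k
    have h : (p * p.conjTranspose) k k = p k k := by rw [h2, h1]
    rw [← h, Matrix.mul_apply, Complex.re_sum]
    refine Finset.sum_congr rfl fun l _ => ?_
    rw [Matrix.conjTranspose_apply, ← Complex.normSq_eq_norm_sq]
    simp [Complex.normSq_apply]
  have htr : ∑ k, (p k k).re = 1 := by
    rw [← Complex.re_sum]
    exact congrArg Complex.re h3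
  have hk : (p i i).re ≤ 1 := by
    rw [← htr]
    refine Finset.single_le_sum (f := fun k => (p k k).re) (fun k _ => ?_) (Finset.mem_univ i)
    rw [hrow]
    positivity
  have hl : ‖p i j‖ ^ 2 ≤ ∑ l, ‖p i l‖ ^ 2 :=
    Finset.single_le_sum (f := fun l => ‖p i l‖ ^ 2) (fun l _ => by positivity) (Finset.mem_univ j)
  rw [hrow] at hk
  nlinarith [norm_nonneg (p i j)]

theorem isCompact_projSpace (N : ℕ) : IsCompact
    {p : Matrix (Fin N) (Fin N) ℂ | p * p = p ∧ p.conjTranspose = p ∧ p.trace = 1} := by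
  refine IsCompact.of_isClosed_subset (isCompact_univ_pi fun _ : Fin N =>
    isCompact_univ_pi fun _ : Fin N => isCompact_closedBall (0 : ℂ) 1) ?_ ?_
  · exact (isClosed_eq (by fun_prop) (by fun_prop)).inter
      ((isClosed_eq (by fun_prop) (by fun_prop)).inter (isClosed_eq (by fun_prop) (by fun_prop)))
  · rintro p ⟨h1, h2, h3⟩ i - j -
    simpa using projSpace_norm_le h1 h2 h3 i j

instance (N : ℕ) : CompactSpace (ProjSpace N) :=
  isCompact_iff_compactSpace.1 (isCompact_projSpace N)

/-- The C*-algebra `C(P^{N-1}_ℂ × P^{N-1}_ℂ)`. -/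
abbrev ProjProd (N : ℕ) : Type := C(ProjSpace N × ProjSpace N, ℂ)

/-- The coordinates of the first factor of `P^{N-1}_ℂ × P^{N-1}_ℂ`, which correspond to the
elements `xᵢ xⱼ*` of the full projective version of `S^{N-1}_{ℂ,*}`. -/
def projProdLeft (N : ℕ) (i j : Fin N) : ProjProd N where
  toFun z := z.1.1 i j
  continuous_toFun :=
    ((continuous_subtype_val.comp continuous_fst).matrix_elem i j)

/-- The coordinates of the second factor of `P^{N-1}_ℂ × P^{N-1}_ℂ`, indexed in such a way that
they correspond to the elements `xᵢ* xⱼ` of the full projective version of `S^{N-1}_{ℂ,*}`. -/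
def projProdRight (N : ℕ) (i j : Fin N) : ProjProd N where
  toFun z := z.2.1 j i
  continuous_toFun :=
    ((continuous_subtype_val.comp continuous_snd).matrix_elem j i)

end HalfClassical

end

universe w

/-!
# The quantum isometry group of the half-classical complex sphere

Everything rests on slicing. If `∑ aᵣ ⊗ bᵣ` vanishes in the minimal tensor product and `g` is a
positive functional on the second factor, then `∑ g(bᵣ) aᵣ = 0` (`slice_eq_zero`), because the GNS
representation of `g` is one of those that define the norm and because positive functionals
separate points (`eq_zero_of_forall_positive`).

Both `P × P` and the half-classical sphere have, for all unit vectors `z` and `w`, a positive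
functional which gives the coordinates `xᵢ xⱼ*` the values `zᵢ z̄ⱼ` and the coordinates `xᵢ* xⱼ` the
values `w̄ᵢ wⱼ`. For the sphere it is a coefficient of the representation on `ℂ²` by the matrices
with rows `(0, zᵢ)` and `(wᵢ, 0)`. Write `uᵢ(z) = ∑ zₐ uᵢₐ`. In the coordinates `pᵢⱼ = xᵢ xⱼ*` and
`qᵢⱼ = xᵢ* xⱼ`, an action carries the relations `pᵢⱼ qₖₗ = qₖₗ pᵢⱼ` and `pᵢⱼ pₖₗ = pₖⱼ pᵢₗ` to the
tensor product, and slicing with these functionals gives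

* `uᵢ(z) uⱼ(z)*` commutes with `uₖ(w)* uₗ(w)`; by polarization in `z` and in `w`, all the `ab*`
  commute with all the `c*d`, for `a, b, c, d` among the entries of `u`;
* `uᵢ(z) uⱼ(z)* uₖ(z) uₗ(z)*` is symmetric in `i` and `k`. Unitarity removes the last factor, and
  polarization in `z` gives that `u i a * star (u j b) * u k c`, symmetrized in `a` and `c`, is
  symmetric in `i` and `k` (`symm_half_commute`). The antipode exchanges rows and
  columns (`IsClosedSubgroup.transpose_relation`), and the sum of the two relations is the
  half-commutation `ab*c = cb*a`, which makes the `ab*` commute, and also the `a*b`.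

So `u` satisfies the relations of `U_N*` (`IsClosedSubgroup.commute_of_action`), and the inclusion
`G ⊂ U_N*` is the universal property of `C(U_N*)`. The sphere satisfies `pᵢⱼ pₖₗ = pₖⱼ pᵢₗ` since
its coordinates half-commute (`sphereCoord_half_commute`), and `P` since its points are matrices of
rank one (`projSpace_minor`).

In the other direction, the comultiplication, counit and antipode of `U_N*` and its action on the
sphere come from universal properties: products of commuting unitary matrices are unitary
(`IsBiunitary.mul`), and the commutation relations pass to sums of products from commuting
families (`projCoords_sum_mul_commute`).
-/

open scoped TensorProduct ComplexOrder
open UniformSpace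

/-! ### Positive functionals and slice maps -/

section Slices

variable {A B : Type*} [CStarAlgebra A] [CStarAlgebra B]

/-- The positive functional given by a linear functional that is nonnegative on all `a* a`. -/
noncomputable def PosFunctional.ofNonneg (f : A →ₗ[ℂ] ℂ) (hf : ∀ a, 0 ≤ f (star a * a)) :
    PosFunctional A :=
  letI := CStarAlgebra.spectralOrder A
  haveI := CStarAlgebra.spectralOrderedRing A
  PositiveLinearMap.mk₀ f fun a ha => by
    obtain ⟨c, rfl⟩ := CStarAlgebra.nonneg_iff_eq_star_mul_self.1 ha
    exact hf c

/-- The linear map underlying a positive functional. -/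
noncomputable def PosFunctional.toLin (φ : PosFunctional A) : A →ₗ[ℂ] ℂ :=
  letI := CStarAlgebra.spectralOrder A
  PositiveLinearMap.toLinearMap φ

/-- Positive functionals separate the points of a C*-algebra. -/
theorem eq_zero_of_forall_positive {s : A}
    (h : ∀ f : A →ₗ[ℂ] ℂ, (∀ a, 0 ≤ f (star a * a)) → f s = 0) : s = 0 := by
  let _ := CStarAlgebra.spectralOrder A
  have _ := CStarAlgebra.spectralOrderedRing A
  -- a nonzero self-adjoint element and its negative cannot both be in the positive cone
  have key : ∀ s : A, (∀ f : A →ₗ[ℂ] ℂ, (∀ a, 0 ≤ f (star a * a)) → f s = 0) →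
      IsSelfAdjoint s → 0 ≤ s := by
    intro s h hs
    by_contra hneg
    obtain ⟨l, r, hl, hr⟩ := geometric_hahn_banach_point_closed (E := A) (t := {a : A | 0 ≤ a})
      (x := s) (convex_Ici 0) CStarAlgebra.isClosed_nonneg hneg
    have hr0 : r < 0 := by simpa using hr 0 (le_refl (0 : A))
    have hpos : ∀ a : A, 0 ≤ a → 0 ≤ l a := by
      intro a ha
      by_contra hla
      rw [not_le] at hla
      have h1 := hr ((r / l a) • a) (smul_nonneg (div_nonneg_of_nonpos hr0.le hla.le) ha)
      rw [map_smul, smul_eq_mul, div_mul_cancel₀ _ hla.ne] at h1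
      exact lt_irrefl _ h1
    -- `x ↦ l (x + x*)` is the real part of a positive functional
    let m : A →ₗ[ℝ] ℝ :=
      { toFun := fun x => l (x + star x)
        map_add' := fun x y => by
          rw [star_add, ← map_add]
          congr 1
          abel
        map_smul' := fun c x => by
          rw [star_smul, star_trivial, ← smul_add, map_smul]
          rfl }
    let f : A →ₗ[ℂ] ℂ :=
      { toFun := fun x => (m x : ℂ) - Complex.I * m (Complex.I • x)
        map_add' := fun x y => by
          simp only [smul_add, map_add, Complex.ofReal_add]
          ring
        map_smul' := fun c x => by
          have h1 : c • x = c.re • x + c.im • (Complex.I • x) := by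
            conv_lhs => rw [← Complex.re_add_im c, add_smul, mul_smul]
            rfl
          have h2 : Complex.I • (c • x) = c.re • (Complex.I • x) - c.im • x := by
            rw [smul_smul, sub_eq_add_neg, ← neg_smul]
            conv_lhs => rw [← Complex.re_add_im c, mul_add, add_smul]
            congr 1
            · rw [mul_comm, mul_smul]; rfl
            · rw [mul_left_comm, Complex.I_mul_I, mul_neg_one, ← Complex.ofReal_neg]; rfl
          rw [h2, h1]
          simp only [map_add, map_sub, map_smul, smul_eq_mul, RingHom.id_apply, Complex.ofReal_add,
            Complex.ofReal_sub, Complex.ofReal_mul]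
          conv_rhs => rw [← Complex.re_add_im c]
          linear_combination ((m (Complex.I • x) : ℂ) * c.im) * Complex.I_mul_I }
    have hfs : ∀ x : A, IsSelfAdjoint x → f x = ((2 * l x : ℝ) : ℂ) := by
      intro x hx
      have h1 : m x = 2 * l x := by
        change l (x + star x) = _
        rw [hx.star_eq, map_add, two_mul]
      have h2 : m (Complex.I • x) = 0 := by
        change l (Complex.I • x + star (Complex.I • x)) = 0
        rw [star_smul, hx.star_eq]
        simp
      change (m x : ℂ) - Complex.I * m (Complex.I • x) = _
      rw [h1, h2]
      simp
    have h0 := h f fun a => by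
      rw [hfs _ (IsSelfAdjoint.star_mul_self a)]
      exact Complex.zero_le_real.2 (mul_nonneg zero_le_two (hpos _ (star_mul_self_nonneg a)))
    rw [hfs s hs] at h0
    have h1 : 2 * l s = 0 := by exact_mod_cast h0
    linarith
  have key2 : ∀ s : A, (∀ f : A →ₗ[ℂ] ℂ, (∀ a, 0 ≤ f (star a * a)) → f s = 0) →
      IsSelfAdjoint s → s = 0 := fun s h hs =>
    le_antisymm (neg_nonneg.1 (key (-s) (fun f hf => by rw [map_neg, h f hf, neg_zero]) hs.neg))
      (key s h hs)
  have hstar : ∀ f : A →ₗ[ℂ] ℂ, (∀ a, 0 ≤ f (star a * a)) → f (star s) = 0 := by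
    intro f hf
    let φ : A →ₚ[ℂ] ℂ := PosFunctional.ofNonneg f hf
    have h1 : φ (star s) = star (φ s) := map_star φ s
    have h2 : φ s = 0 := h f hf
    rw [h2, star_zero] at h1
    exact h1
  have hre : s + star s = 0 := key2 _ (fun f hf => by rw [map_add, h f hf, hstar f hf, add_zero])
    (IsSelfAdjoint.add_star_self s)
  have him : Complex.I • (s - star s) = 0 :=
    key2 _ (fun f hf => by rw [map_smul, map_sub, h f hf, hstar f hf, sub_zero, smul_zero]) (by
      rw [IsSelfAdjoint, star_smul, star_sub, star_star]
      simp [← smul_neg])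
  have h1 : s - star s = 0 := (smul_eq_zero.1 him).resolve_left Complex.I_ne_zero
  have h2 : (2 : ℂ) • s = 0 := by
    rw [two_smul]
    calc s + s = (s + star s) + (s - star s) := by abel
      _ = 0 := by rw [hre, h1, add_zero]
  exact (smul_eq_zero.1 h2).resolve_left two_ne_zero

/-- The slice map `a ⊗ b ↦ g b • a` of a functional `g`. -/
noncomputable def slice (A : Type*) [CStarAlgebra A] (g : B →ₗ[ℂ] ℂ) : A ⊗[ℂ] B →ₗ[ℂ] A :=
  (TensorProduct.rid ℂ A).toLinearMap ∘ₗ g.lTensor A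

theorem slice_tmul (g : B →ₗ[ℂ] ℂ) (a : A) (b : B) : slice A g (a ⊗ₜ b) = g b • a := by
  simp [slice]

/-- The functional `a ↦ ⟨ξ, π a ξ⟩`. -/
noncomputable def vecFunctional {H : Type*} [NormedAddCommGroup H] [InnerProductSpace ℂ H]
    [CompleteSpace H] (π : A →⋆ₐ[ℂ] (H →L[ℂ] H)) (ξ : H) : A →ₗ[ℂ] ℂ where
  toFun a := inner ℂ ξ (π a ξ)
  map_add' a b := by rw [map_add, ← inner_add_right]; rfl
  map_smul' c a := by rw [map_smul, RingHom.id_apply, smul_eq_mul, ← inner_smul_right]; rfl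

theorem exists_vecFunctional_gnsRep (φ : PosFunctional A) :
    ∃ ξ : GNSSpace φ, vecFunctional (gnsRep φ) ξ = φ.toLin := by
  let _ := CStarAlgebra.spectralOrder A
  have _ := CStarAlgebra.spectralOrderedRing A
  let ψ : A →ₚ[ℂ] ℂ := φ
  refine ⟨((ψ.toPreGNS 1 : ψ.PreGNS) : ψ.GNS), LinearMap.ext fun a => ?_⟩
  change inner ℂ ((ψ.toPreGNS 1 : ψ.PreGNS) : ψ.GNS)
    (ψ.gnsStarAlgHom a ((ψ.toPreGNS 1 : ψ.PreGNS) : ψ.GNS)) = ψ a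
  have h : ψ.gnsStarAlgHom a ((ψ.toPreGNS 1 : ψ.PreGNS) : ψ.GNS) =
      ((ψ.toPreGNS a : ψ.PreGNS) : ψ.GNS) := by
    change ψ.gnsNonUnitalStarAlgHom a _ = _
    rw [PositiveLinearMap.gnsNonUnitalStarAlgHom_apply_coe]
    simp
  rw [h, Completion.inner_coe, PositiveLinearMap.preGNS_inner_def]
  simp

theorem CStarSeminorm.apply_eq_zero_of_ofHom {F B : Type*} [Ring F] [StarRing F] [Algebra ℂ F]
    [CStarAlgebra B] {π : F →⋆ₐ[ℂ] B} {a : F} (h : (CStarSeminorm.ofHom π).toFun a = 0) :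
    π a = 0 := norm_eq_zero.1 h

theorem vecFunctional_slice_eq_zero {H K : Type*} [NormedAddCommGroup H] [InnerProductSpace ℂ H]
    [CompleteSpace H] [NormedAddCommGroup K] [InnerProductSpace ℂ K] [CompleteSpace K]
    {π : A →⋆ₐ[ℂ] (H →L[ℂ] H)} {ρ : B →⋆ₐ[ℂ] (K →L[ℂ] K)} {t : A ⊗[ℂ] B}
    (ht : repTensor π ρ t = 0) (ξ : H) (η : K) :
    vecFunctional π ξ (slice A (vecFunctional ρ η) t) = 0 := by
  have h1 : ∀ t : A ⊗[ℂ] B,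
      inner ℂ ((ξ ⊗ₜ[ℂ] η : H ⊗[ℂ] K) : HilbertTensor H K)
        (repTensor π ρ t ((ξ ⊗ₜ[ℂ] η : H ⊗[ℂ] K) : HilbertTensor H K)) =
          vecFunctional π ξ (slice A (vecFunctional ρ η) t) := by
    intro t
    induction t using TensorProduct.induction_on with
    | zero => simp
    | add a b ha hb => rw [map_add, map_add, map_add, ← ha, ← hb, ← inner_add_right]; rfl
    | tmul a b =>
      rw [repTensor_tmul, opTensor_tmul, Completion.inner_coe, TensorProduct.inner_tmul,
        slice_tmul, map_smul, smul_eq_mul, mul_comm]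
      rfl
  rw [← h1, ht]
  simp

/-- Slices by positive functionals are well defined on the image of the algebraic tensor product
in the minimal one: both the GNS representation of `g` and those that separate the points of `A`
are among the representations that define the minimal norm. -/
theorem slice_eq_zero {t : A ⊗[ℂ] B} (ht : (minSeminorm A B).toCompl t = 0) {g : B →ₗ[ℂ] ℂ}
    (hg : ∀ b, 0 ≤ g (star b * b)) : slice A g t = 0 := by
  refine eq_zero_of_forall_positive fun f hf => ?_
  have h1 : (minSeminorm A B).toFun t = 0 := by
    rw [← CStarSeminorm.norm_toCompl, ht, norm_zero]
  obtain ⟨φ, rfl⟩ : ∃ φ : PosFunctional A, φ.toLin = f := ⟨.ofNonneg f hf, rfl⟩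
  obtain ⟨ψ, rfl⟩ : ∃ ψ : PosFunctional B, ψ.toLin = g := ⟨.ofNonneg g hg, rfl⟩
  obtain ⟨ξ, hξ⟩ := exists_vecFunctional_gnsRep φ
  obtain ⟨η, hη⟩ := exists_vecFunctional_gnsRep ψ
  have h2 : (gnsTensorSeminorm A B (φ, ψ)).toFun t = 0 :=
    le_antisymm (h1 ▸ le_ciSup (gnsTensorSeminorm_bddAbove t) (φ, ψ)) (CStarSeminorm.nonneg _ _)
  rw [← hξ, ← hη]
  exact vecFunctional_slice_eq_zero (CStarSeminorm.apply_eq_zero_of_ofHom h2) ξ η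

end Slices

/-! ### Polarization -/

section Polarization

variable {V M : Type*} [AddCommGroup V] [Module ℂ V] [AddCommGroup M] [Module ℂ M]

theorem sesquilinear_eq_zero {F : V → V → M}
    (add₁ : ∀ x x' y, F (x + x') y = F x y + F x' y)
    (add₂ : ∀ x y y', F x (y + y') = F x y + F x y')
    (smul₁ : ∀ (c : ℂ) x y, F (c • x) y = c • F x y)
    (smul₂ : ∀ (c : ℂ) x y, F x (c • y) = star c • F x y)
    (h : ∀ x, F x x = 0) (x y : V) : F x y = 0 := by
  have h1 : F x y + F y x = 0 := by
    have := h (x + y)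
    simpa only [add₁, add₂, h, zero_add, add_zero] using this
  have h2 : -Complex.I • F x y + Complex.I • F y x = 0 := by
    have := h (x + Complex.I • y)
    simpa only [add₁, add₂, smul₁, smul₂, h, smul_zero, zero_add, add_zero, Complex.star_def,
      Complex.conj_I] using this
  have h3 : (2 * Complex.I) • F x y = 0 := by
    linear_combination (norm := module) Complex.I • h1 - h2
  exact (smul_eq_zero.1 h3).resolve_left (by simp)

/-- Polarization for a form `T` that is linear in the outer variables and conjugate-linear in the
middle one. -/
theorem add_swap_eq_zero {T : V → V → V → M}
    (add₁ : ∀ x x' y z, T (x + x') y z = T x y z + T x' y z)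
    (add₂ : ∀ x y y' z, T x (y + y') z = T x y z + T x y' z)
    (add₃ : ∀ x y z z', T x y (z + z') = T x y z + T x y z')
    (smul₁ : ∀ (c : ℂ) x y z, T (c • x) y z = c • T x y z)
    (smul₂ : ∀ (c : ℂ) x y z, T x (c • y) z = star c • T x y z)
    (smul₃ : ∀ (c : ℂ) x y z, T x y (c • z) = c • T x y z)
    (h : ∀ x, T x x x = 0) (x y z : V) : T x y z + T z y x = 0 := by
  -- `T x y x` is the coefficient of `s²` in `T (s x + y) (s x + y) (s x + y)`; averaging over the
  -- fourth roots of unity isolates it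
  have key : ∀ x y, T x y x = 0 := by
    intro x y
    have hs : ∀ s : ℂ, s ^ 2 • T x y x + s • (T x y y + T y y x) + star s • T y x y +
        (s * star s) • (T x x y + T y x x) = 0 := by
      intro s
      have h0 := h (s • x + y)
      simp only [add₁, add₂, add₃, smul₁, smul₂, smul₃, h, smul_zero, zero_add, add_zero] at h0
      linear_combination (norm := module) h0
    have h1 := hs 1
    have h2 := hs (-1)
    have h3 := hs Complex.I
    have h4 := hs (-Complex.I)
    simp only [star_neg, Complex.star_def, Complex.conj_I, map_one, neg_sq, Complex.I_sq, one_pow,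
      mul_neg, neg_mul, neg_neg, Complex.I_mul_I, one_mul] at h1 h2 h3 h4
    have h5 : (4 : ℂ) • T x y x = 0 := by
      linear_combination (norm := module) h1 + h2 - h3 - h4
    exact (smul_eq_zero.1 h5).resolve_left (by norm_num)
  have h1 := key (x + z) y
  simpa only [add₁, add₃, key, zero_add, add_zero] using h1

end Polarization

/-! ### Linear combinations of the rows of a matrix -/

section RowComb

variable {N : ℕ} {A : Type*} [CStarAlgebra A]

/-- The elements `uᵢ(z) = ∑ₐ zₐ uᵢₐ`, as linear functions of `z`. -/
noncomputable def rowComb (u : Matrix (Fin N) (Fin N) A) (i : Fin N) : (Fin N → ℂ) →ₗ[ℂ] A :=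
  Fintype.linearCombination ℂ (u i)

theorem rowComb_apply (u : Matrix (Fin N) (Fin N) A) (i : Fin N) (z : Fin N → ℂ) :
    rowComb u i z = ∑ a, z a • u i a := Fintype.linearCombination_apply ..

theorem rowComb_single (u : Matrix (Fin N) (Fin N) A) (i a : Fin N) :
    rowComb u i (Pi.single a 1) = u i a := by
  simp [rowComb, Fintype.linearCombination_apply_single]

theorem rowComb_mul_star (u : Matrix (Fin N) (Fin N) A) (i j : Fin N) (z w : Fin N → ℂ) :
    rowComb u i z * star (rowComb u j w) =
      ∑ a, ∑ b, (z a * star (w b)) • (u i a * star (u j b)) := by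
  simp only [rowComb_apply, star_sum, star_smul, Finset.sum_mul_sum, smul_mul_smul_comm]

theorem star_rowComb_mul (u : Matrix (Fin N) (Fin N) A) (i j : Fin N) (z w : Fin N → ℂ) :
    star (rowComb u i z) * rowComb u j w =
      ∑ a, ∑ b, (star (z a) * w b) • (star (u i a) * u j b) := by
  simp only [rowComb_apply, star_sum, star_smul, Finset.sum_mul_sum, smul_mul_smul_comm]

theorem eq_zero_or_exists_unit (z : Fin N → ℂ) :
    z = 0 ∨ ∃ (c : ℂ) (w : Fin N → ℂ), ∑ a, w a * star (w a) = 1 ∧ z = c • w := by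
  by_cases hz : z = 0
  · exact Or.inl hz
  right
  have h0 : 0 < ∑ a, ‖z a‖ ^ 2 := by
    obtain ⟨a, ha⟩ := Function.ne_iff.1 hz
    exact Finset.sum_pos' (fun _ _ => by positivity)
      ⟨a, Finset.mem_univ a, by have := norm_pos_iff.2 ha; positivity⟩
  set r : ℝ := √(∑ a, ‖z a‖ ^ 2) with hr
  have hr0 : 0 < r := Real.sqrt_pos.2 h0
  have hr0' : (r : ℂ) ≠ 0 := by exact_mod_cast hr0.ne'
  refine ⟨r, (r : ℂ)⁻¹ • z, ?_, by rw [smul_smul, mul_inv_cancel₀ hr0', one_smul]⟩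
  have h1 : ∑ a, z a * star (z a) = (r : ℂ) ^ 2 := by
    rw [← Complex.ofReal_pow, hr, Real.sq_sqrt h0.le, Complex.ofReal_sum]
    refine Finset.sum_congr rfl fun a _ => ?_
    rw [Complex.star_def, Complex.mul_conj, Complex.normSq_eq_norm_sq]
  calc ∑ a, ((r : ℂ)⁻¹ • z) a * star (((r : ℂ)⁻¹ • z) a)
      = ((r : ℂ)⁻¹) ^ 2 * ∑ a, z a * star (z a) := by
        rw [Finset.mul_sum]
        refine Finset.sum_congr rfl fun a _ => ?_
        simp only [Pi.smul_apply, smul_eq_mul, star_mul', Complex.star_def, map_inv₀,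
          Complex.conj_ofReal]
        ring
    _ = 1 := by rw [h1, ← mul_pow, inv_mul_cancel₀ hr0', one_pow]

end RowComb

/-! ### From relations on unit vectors to commutation relations -/

section HalfCommutation

variable {N : ℕ} {A : Type*} [CStarAlgebra A] {u : Matrix (Fin N) (Fin N) A}

/-- Symmetrized half-commutation relations for the entries of `u`, from relations between the
`uᵢ(z) uⱼ(z)*` for unit vectors `z`. The last factor `uₗ(z)*` is removed with `u* u = 1`. -/
theorem symm_half_commute (hu : u.conjTranspose * u = 1)
    (h : ∀ z : Fin N → ℂ, ∑ a, z a * star (z a) = 1 → ∀ i j k l,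
      rowComb u i z * star (rowComb u j z) * (rowComb u k z * star (rowComb u l z)) =
        rowComb u k z * star (rowComb u j z) * (rowComb u i z * star (rowComb u l z)))
    (i j k a b c : Fin N) :
    u i a * star (u j b) * u k c + u i c * star (u j b) * u k a =
      u k a * star (u j b) * u i c + u k c * star (u j b) * u i a := by
  have hl : ∀ z : Fin N → ℂ, ∑ a, z a * star (z a) = 1 →
      ∑ l, star (rowComb u l z) * rowComb u l z = 1 := by
    intro z hz
    have hu' : ∀ a b, ∑ l, star (u l a) * u l b = if a = b then 1 else 0 := fun a b => by
      rw [← Matrix.one_apply, ← hu]; rfl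
    simp only [star_rowComb_mul]
    rw [Finset.sum_comm]
    simp_rw [Finset.sum_comm (s := Finset.univ) (t := Finset.univ)
      (f := fun l b => (star (z _) * z b) • (star (u l _) * u l b)), ← Finset.smul_sum, hu']
    simp only [smul_ite, smul_zero, Finset.sum_ite_eq, Finset.mem_univ, if_true]
    rw [← Finset.sum_smul]
    simp_rw [mul_comm (star _)]
    rw [hz, one_smul]
  have h1 : ∀ z : Fin N → ℂ, ∑ a, z a * star (z a) = 1 →
      rowComb u i z * star (rowComb u j z) * rowComb u k z =
        rowComb u k z * star (rowComb u j z) * rowComb u i z := by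
    intro z hz
    have h2 : ∀ x y : A, x * y = ∑ l, x * (y * star (rowComb u l z)) * rowComb u l z := by
      intro x y
      simp_rw [← mul_assoc, mul_assoc (x * y), ← Finset.mul_sum, hl z hz, mul_one]
    rw [h2, h2 _ (rowComb u i z)]
    exact Finset.sum_congr rfl fun l _ => by rw [h z hz]
  have h3 := add_swap_eq_zero (V := Fin N → ℂ)
    (T := fun x y z => rowComb u i x * star (rowComb u j y) * rowComb u k z -
      rowComb u k x * star (rowComb u j y) * rowComb u i z)
    (fun x x' y z => by simp only [map_add, add_mul]; abel)
    (fun x y y' z => by simp only [map_add, star_add, mul_add, add_mul]; abel)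
    (fun x y z z' => by simp only [map_add, mul_add]; abel)
    (fun c x y z => by simp only [map_smul, smul_mul_assoc, smul_sub])
    (fun c x y z => by
      simp only [map_smul, star_smul, smul_mul_assoc, mul_smul_comm, smul_sub])
    (fun c x y z => by simp only [map_smul, mul_smul_comm, smul_sub])
    (fun z => by
      rcases eq_zero_or_exists_unit z with rfl | ⟨c, w, hw, rfl⟩
      · simp
      · simp only [map_smul, star_smul, smul_mul_assoc, mul_smul_comm, h1 w hw, sub_self])
    (Pi.single a 1) (Pi.single b 1) (Pi.single c 1)
  simp only [rowComb_single] at h3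
  rw [← sub_eq_zero, ← h3]
  abel

/-- The antipode, followed by the involution, is multiplicative and transposes `u`; so relations
between monomials `x y* z` in the entries of `u` may be transposed. -/
theorem IsClosedSubgroup.transpose_relation (hu : IsClosedSubgroup u) {i j k a b c : Fin N}
    (h : u i a * star (u j b) * u k c + u i c * star (u j b) * u k a =
      u k a * star (u j b) * u i c + u k c * star (u j b) * u i a) :
    u a i * star (u b j) * u c k + u c i * star (u b j) * u a k =
      u a k * star (u b j) * u c i + u c k * star (u b j) * u a i := by
  obtain ⟨S, hS⟩ := hu.antipode
  have h1 : polyCoord (entries u) (i, a) * star (polyCoord (entries u) (j, b)) *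
        polyCoord (entries u) (k, c) + polyCoord (entries u) (i, c) *
        star (polyCoord (entries u) (j, b)) * polyCoord (entries u) (k, a) =
      polyCoord (entries u) (k, a) * star (polyCoord (entries u) (j, b)) *
        polyCoord (entries u) (i, c) + polyCoord (entries u) (k, c) *
        star (polyCoord (entries u) (j, b)) * polyCoord (entries u) (i, a) := Subtype.ext h
  have h2 := congrArg (fun x => ((star (S x).unop : polyAlg (entries u)) : A)) h1
  simp only [map_add, map_mul, StarHomClass.map_star, hS, MulOpposite.unop_add,
    MulOpposite.unop_mul, MulOpposite.unop_star, MulOpposite.unop_op, star_add,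
    star_star] at h2
  simpa [entries, polyCoord, mul_assoc] using h2

/-- Half-commutation `x y* z = z y* x`, together with the commutation of the `x y*` with the
`z* t`, gives the relations of `U_N*`. -/
theorem projCoords_commute {ι : Type*} {x : ι → A}
    (h1 : ∀ i j k, x i * star (x j) * x k = x k * star (x j) * x i)
    (h2 : ∀ i j k l, x i * star (x j) * (star (x k) * x l) =
      star (x k) * x l * (x i * star (x j))) :
    ∀ y ∈ projCoords x, ∀ z ∈ projCoords x, y * z = z * y := by
  have h1' : ∀ i j k, star (x i) * x j * star (x k) = star (x k) * x j * star (x i) := by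
    intro i j k
    simpa [mul_assoc] using congrArg star (h1 k j i)
  rintro _ ⟨i, j, rfl | rfl⟩ _ ⟨k, l, rfl | rfl⟩
  · rw [← mul_assoc, h1, mul_assoc, mul_assoc, ← mul_assoc (star (x j)), h1', mul_assoc, mul_assoc]
  · exact h2 i j k l
  · exact (h2 k l i j).symm
  · rw [← mul_assoc, h1', mul_assoc, mul_assoc, ← mul_assoc (x j), h1, mul_assoc, mul_assoc]

/-- For a closed quantum subgroup of `U_N⁺`, the relations of `U_N*` follow from relations
between the elements `uᵢ(z) uⱼ(z)*` and `uₖ(w)* uₗ(w)`, with `z` and `w` unit vectors. -/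
theorem IsClosedSubgroup.projCoords_commute (hu : IsClosedSubgroup u)
    (h1 : ∀ z : Fin N → ℂ, ∑ a, z a * star (z a) = 1 → ∀ i j k l,
      rowComb u i z * star (rowComb u j z) * (rowComb u k z * star (rowComb u l z)) =
        rowComb u k z * star (rowComb u j z) * (rowComb u i z * star (rowComb u l z)))
    (h2 : ∀ z w : Fin N → ℂ, ∑ a, z a * star (z a) = 1 → ∑ a, w a * star (w a) = 1 → ∀ i j k l,
      rowComb u i z * star (rowComb u j z) * (star (rowComb u k w) * rowComb u l w) =
        star (rowComb u k w) * rowComb u l w * (rowComb u i z * star (rowComb u j z))) :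
    ∀ y ∈ projCoords (entries u), ∀ z ∈ projCoords (entries u), y * z = z * y := by
  refine _root_.projCoords_commute ?_ ?_
  · rintro ⟨i, a⟩ ⟨j, b⟩ ⟨k, c⟩
    -- the transposed relation is symmetrized in the row indices instead of the column indices
    have e1 := symm_half_commute hu.star_mul h1 i j k a b c
    have e2 := hu.transpose_relation (symm_half_commute hu.star_mul h1 a b c i j k)
    have e3 : (2 : ℂ) • (u i a * star (u j b) * u k c - u k c * star (u j b) * u i a) = 0 := by
      linear_combination (norm := module) e1 + e2
    exact sub_eq_zero.1 ((smul_eq_zero.1 e3).resolve_left two_ne_zero)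
  · rintro ⟨i, a⟩ ⟨j, b⟩ ⟨k, c⟩ ⟨l, d⟩
    have hsmul : ∀ (z w : Fin N → ℂ) i j k l,
        rowComb u i z * star (rowComb u j z) * (star (rowComb u k w) * rowComb u l w) -
          star (rowComb u k w) * rowComb u l w * (rowComb u i z * star (rowComb u j z)) = 0 := by
      intro z w i j k l
      rcases eq_zero_or_exists_unit z with rfl | ⟨r, z', hz, rfl⟩
      · simp
      rcases eq_zero_or_exists_unit w with rfl | ⟨s, w', hw, rfl⟩
      · simp
      simp only [map_smul, star_smul, smul_mul_assoc, mul_smul_comm, h2 z' w' hz hw, sub_eq_zero]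
      module
    have e1 : ∀ w : Fin N → ℂ, u i a * star (u j b) * (star (rowComb u k w) * rowComb u l w) -
        star (rowComb u k w) * rowComb u l w * (u i a * star (u j b)) = 0 := by
      intro w
      have := sesquilinear_eq_zero (V := Fin N → ℂ)
        (F := fun x y => rowComb u i x * star (rowComb u j y) *
          (star (rowComb u k w) * rowComb u l w) -
          star (rowComb u k w) * rowComb u l w * (rowComb u i x * star (rowComb u j y)))
        (fun x x' y => by simp only [map_add, add_mul, mul_add]; abel)
        (fun x y y' => by simp only [map_add, star_add, add_mul, mul_add]; abel)
        (fun c x y => by simp only [map_smul, smul_mul_assoc, mul_smul_comm, smul_sub])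
        (fun c x y => by
          simp only [map_smul, star_smul, smul_mul_assoc, mul_smul_comm, smul_sub])
        (fun z => hsmul z w i j k l) (Pi.single a 1) (Pi.single b 1)
      simpa only [rowComb_single] using this
    have e2 := sesquilinear_eq_zero (V := Fin N → ℂ)
      (F := fun x y => u i a * star (u j b) * (star (rowComb u k y) * rowComb u l x) -
        star (rowComb u k y) * rowComb u l x * (u i a * star (u j b)))
      (fun x x' y => by simp only [map_add, add_mul, mul_add]; abel)
      (fun x y y' => by simp only [map_add, star_add, add_mul, mul_add]; abel)
      (fun c x y => by simp only [map_smul, smul_mul_assoc, mul_smul_comm, smul_sub])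
      (fun c x y => by
        simp only [map_smul, star_smul, smul_mul_assoc, mul_smul_comm, smul_sub])
      e1 (Pi.single d 1) (Pi.single c 1)
    simp only [rowComb_single] at e2
    exact sub_eq_zero.1 e2

end HalfCommutation

/-! ### Universal C*-algebras -/

section Universal

/-- A unital `*`-homomorphism dominated by a C*-seminorm extends to the completion. -/
theorem CStarSeminorm.exists_extension {F B : Type*} [Ring F] [StarRing F] [Algebra ℂ F]
    [StarModule ℂ F] [CStarAlgebra B] (p : CStarSeminorm F) (π : F →⋆ₐ[ℂ] B)
    (h : ∀ a, ‖π a‖ ≤ p.toFun a) :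
    ∃ ρ : p.Compl →⋆ₐ[ℂ] B, ∀ a, ρ (p.toCompl a) = π a := by
  let f : p.Space →+* B := (π : F →+* B)
  have hf : Continuous f := AddMonoidHomClass.continuous_of_bound f 1 fun a => by
    rw [one_mul]; exact h a
  let ρ : p.Compl →+* B := Completion.extensionHom f hf
  have hρ : ∀ a : p.Space, ρ (a : p.Compl) = f a := Completion.extensionHom_coe f hf
  have hc : Continuous ρ := Completion.continuous_extension
  refine ⟨{ ρ with
    commutes' := fun c => (hρ _).trans (AlgHomClass.commutes π c)
    map_star' := fun x => ?_ }, hρ⟩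
  change ρ (star x) = star (ρ x)
  induction x using Completion.induction_on with
  | hp => exact isClosed_eq (hc.comp p.continuous_star) hc.star
  | ih a => rw [p.coe_star, hρ, hρ]; exact StarHomClass.map_star π a

/-- The `*`-homomorphism from the free `*`-algebra with prescribed values on the generators. -/
noncomputable def FreeStarAlg.lift {ι B : Type*} [Ring B] [StarRing B] [Algebra ℂ B]
    [StarModule ℂ B] (x : ι → B) : FreeStarAlg ι →⋆ₐ[ℂ] B :=
  let f : FreeStarAlg ι →ₐ[ℂ] B :=
    FreeAlgebra.lift ℂ fun s : ι × Bool => if s.2 then star (x s.1) else x s.1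
  { f with
    map_star' := fun a => by
      change f (star a) = star (f a)
      have hf : ∀ s : ι × Bool, f (letter s) = if s.2 then star (x s.1) else x s.1 :=
        fun s => FreeAlgebra.lift_ι_apply _ s
      induction a using FreeStarAlg.induction with
      | h1 c => rw [star_algebraMap, AlgHom.commutes, AlgHom.commutes, algebraMap_star_comm]
      | h2 s =>
        rw [star_letter, hf, hf]
        cases s.2 <;> simp
      | h3 a b ha hb => rw [star_mul, map_mul, map_mul, star_mul, ha, hb]
      | h4 a b ha hb => rw [star_add, map_add, map_add, star_add, ha, hb] }

theorem FreeStarAlg.lift_gen {ι B : Type*} [Ring B] [StarRing B] [Algebra ℂ B]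
    [StarModule ℂ B] (x : ι → B) (i : ι) : FreeStarAlg.lift x (FreeStarAlg.gen i) = x i :=
  FreeAlgebra.lift_ι_apply (fun s : ι × Bool => if s.2 then star (x s.1) else x s.1) (i, false)

variable {ι : Type*} {R : Set (FreeStarAlg ι)} (hR : IsBoundedRel R)

theorem UnivCStar.toCompl_eq_zero {r : FreeStarAlg ι} (hr : r ∈ R) :
    (univSeminorm R hR).toCompl r = 0 := by
  rw [← norm_eq_zero, CStarSeminorm.norm_toCompl]
  refine le_antisymm (Real.iSup_le (fun p => (p.2 r hr).le) le_rfl) (CStarSeminorm.nonneg _ _)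

/-- The universal property of the universal C*-algebra. -/
theorem UnivCStar.exists_lift {B : Type*} [CStarAlgebra B] (x : ι → B)
    (hx : ∀ r ∈ R, FreeStarAlg.lift x r = 0) :
    ∃ π : UnivCStar R hR →⋆ₐ[ℂ] B, ∀ i, π (UnivCStar.gen R hR i) = x i := by
  let p : RelSeminorm R := ⟨CStarSeminorm.ofHom (FreeStarAlg.lift x), fun r hr => by
    change ‖FreeStarAlg.lift x r‖ = 0
    rw [hx r hr, norm_zero]⟩
  obtain ⟨π, hπ⟩ := (univSeminorm R hR).exists_extension (FreeStarAlg.lift x)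
    fun a => le_ciSup (hR.bddAbove a) p
  exact ⟨π, fun i => (hπ _).trans (FreeStarAlg.lift_gen x i)⟩

/-- The universal C*-algebra is generated by its generators. -/
theorem UnivCStar.polyAlg_gen_dense :
    (polyAlg (UnivCStar.gen R hR)).topologicalClosure = ⊤ := by
  have h : ∀ a : FreeStarAlg ι, (univSeminorm R hR).toCompl a ∈ polyAlg (UnivCStar.gen R hR) := by
    intro a
    induction a using FreeStarAlg.induction with
    | h1 c => rw [AlgHomClass.commutes]; exact algebraMap_mem _ c
    | h2 s =>
      obtain ⟨i, b⟩ := s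
      cases b with
      | false => exact coord_mem_polyAlg _ i
      | true =>
        have h2 : FreeStarAlg.letter (i, true) = star (FreeStarAlg.gen i) :=
          (FreeStarAlg.star_letter (i, false)).symm
        rw [h2, StarHomClass.map_star]
        exact star_mem (coord_mem_polyAlg (UnivCStar.gen R hR) i)
    | h3 a b ha hb => rw [map_mul]; exact mul_mem ha hb
    | h4 a b ha hb => rw [map_add]; exact add_mem ha hb
  refine top_unique fun x _ => ?_
  rw [← SetLike.mem_coe, StarSubalgebra.topologicalClosure_coe]
  exact closure_mono (Set.range_subset_iff.2 h) ((univSeminorm R hR).denseRange_toCompl x)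

theorem projCoords_comp {F A B : Type*} [Semiring A] [StarRing A] [Semiring B] [StarRing B]
    [FunLike F A B] [MulHomClass F A B] [StarHomClass F A B] (π : F) (x : ι → A) :
    projCoords (fun i => π (x i)) = π '' projCoords x := by
  ext y
  constructor
  · rintro ⟨i, j, rfl | rfl⟩
    · exact ⟨_, ⟨i, j, Or.inl rfl⟩, by rw [map_mul, StarHomClass.map_star]⟩
    · exact ⟨_, ⟨i, j, Or.inr rfl⟩, by rw [map_mul, StarHomClass.map_star]⟩
  · rintro ⟨_, ⟨i, j, rfl | rfl⟩, rfl⟩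
    · exact ⟨i, j, Or.inl (by rw [map_mul, StarHomClass.map_star])⟩
    · exact ⟨i, j, Or.inr (by rw [map_mul, StarHomClass.map_star])⟩

theorem UnivCStar.projCoords_commute (h : halfClassicalRel FreeStarAlg.gen ⊆ R) :
    ∀ y ∈ projCoords (UnivCStar.gen R hR), ∀ z ∈ projCoords (UnivCStar.gen R hR),
      y * z = z * y := by
  intro y hy z hz
  change y ∈ projCoords (fun i => (univSeminorm R hR).toCompl (FreeStarAlg.gen i)) at hy
  change z ∈ projCoords (fun i => (univSeminorm R hR).toCompl (FreeStarAlg.gen i)) at hz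
  rw [projCoords_comp] at hy hz
  obtain ⟨y, hy, rfl⟩ := hy
  obtain ⟨z, hz, rfl⟩ := hz
  have := UnivCStar.toCompl_eq_zero hR (h ⟨y, hy, z, hz, rfl⟩)
  rwa [map_sub, map_mul, map_mul, sub_eq_zero] at this

theorem FreeStarAlg.lift_halfClassicalRel {B : Type*} [Ring B] [StarRing B] [Algebra ℂ B]
    [StarModule ℂ B] {x : ι → B}
    (hx : ∀ y ∈ projCoords x, ∀ z ∈ projCoords x, y * z = z * y) :
    ∀ r ∈ halfClassicalRel (FreeStarAlg.gen (ι := ι)), FreeStarAlg.lift x r = 0 := by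
  rintro _ ⟨y, hy, z, hz, rfl⟩
  have h : projCoords x = FreeStarAlg.lift x '' projCoords FreeStarAlg.gen := by
    rw [← projCoords_comp]
    simp only [FreeStarAlg.lift_gen]
  rw [map_sub, map_mul, map_mul, sub_eq_zero]
  exact hx _ (h ▸ ⟨y, hy, rfl⟩) _ (h ▸ ⟨z, hz, rfl⟩)

end Universal

/-! ### The relations of the half-classical sphere and unitary group -/

section Relations

/-- The relations `u* = u⁻¹` and `uᵗ = ū⁻¹`. -/
structure IsBiunitary {N : ℕ} {A : Type*} [Ring A] [StarRing A]
    (u : Matrix (Fin N) (Fin N) A) : Prop where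
  mul_star : u * u.conjTranspose = 1
  star_mul : u.conjTranspose * u = 1
  transpose_mul : u.transpose * u.map star = 1
  mul_transpose : u.map star * u.transpose = 1

theorem IsClosedSubgroup.isBiunitary {N : ℕ} {A : Type*} [CStarAlgebra A]
    {u : Matrix (Fin N) (Fin N) A} (hu : IsClosedSubgroup u) : IsBiunitary u :=
  ⟨hu.mul_star, hu.star_mul, hu.transpose_mul, hu.mul_transpose⟩

variable {N : ℕ} {B : Type*} [CStarAlgebra B]

theorem HalfUnitary.exists_lift {v : Matrix (Fin N) (Fin N) B} (hv : IsBiunitary v)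
    (hc : ∀ y ∈ projCoords (entries v), ∀ z ∈ projCoords (entries v), y * z = z * y) :
    ∃ π : HalfUnitary N →⋆ₐ[ℂ] B, ∀ i j, π (unitaryCoord N i j) = v i j := by
  obtain ⟨π, hπ⟩ := UnivCStar.exists_lift (unitaryRel_bounded N) (entries v) (by
    have hg : ∀ i j, FreeStarAlg.lift (entries v) (freeMatrix N i j) = v i j :=
      fun i j => FreeStarAlg.lift_gen _ (i, j)
    rintro r (⟨i, j, rfl | rfl | rfl | rfl⟩ | hr)
    · rw [← sub_eq_zero.2 (congrFun₂ hv.mul_star i j)]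
      simp [Matrix.mul_apply, StarHomClass.map_star, hg, Matrix.one_apply,
        apply_ite (FreeStarAlg.lift (entries v))]
    · rw [← sub_eq_zero.2 (congrFun₂ hv.star_mul i j)]
      simp [Matrix.mul_apply, StarHomClass.map_star, hg, Matrix.one_apply,
        apply_ite (FreeStarAlg.lift (entries v))]
    · rw [← sub_eq_zero.2 (congrFun₂ hv.transpose_mul i j)]
      simp [Matrix.mul_apply, StarHomClass.map_star, hg, Matrix.one_apply,
        apply_ite (FreeStarAlg.lift (entries v))]
    · rw [← sub_eq_zero.2 (congrFun₂ hv.mul_transpose i j)]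
      simp [Matrix.mul_apply, StarHomClass.map_star, hg, Matrix.one_apply,
        apply_ite (FreeStarAlg.lift (entries v))]
    · exact FreeStarAlg.lift_halfClassicalRel hc r hr)
  exact ⟨π, fun i j => hπ (i, j)⟩

theorem unitaryCoord_isBiunitary (N : ℕ) : IsBiunitary (unitaryCoord N) := by
  have h0 := fun r hr => UnivCStar.toCompl_eq_zero (r := r) (unitaryRel_bounded N) hr
  have hg : ∀ i j, (univSeminorm _ (unitaryRel_bounded N)).toCompl (freeMatrix N i j) =
    unitaryCoord N i j := fun i j => rfl
  refine ⟨?_, ?_, ?_, ?_⟩ <;> refine Matrix.ext fun i j => sub_eq_zero.1 ?_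
  · rw [← h0 _ (Or.inl ⟨i, j, Or.inl rfl⟩)]
    simp [Matrix.mul_apply, StarHomClass.map_star, hg, Matrix.one_apply,
      apply_ite (univSeminorm _ (unitaryRel_bounded N)).toCompl]
  · rw [← h0 _ (Or.inl ⟨i, j, Or.inr (Or.inl rfl)⟩)]
    simp [Matrix.mul_apply, StarHomClass.map_star, hg, Matrix.one_apply,
      apply_ite (univSeminorm _ (unitaryRel_bounded N)).toCompl]
  · rw [← h0 _ (Or.inl ⟨i, j, Or.inr (Or.inr (Or.inl rfl))⟩)]
    simp [Matrix.mul_apply, StarHomClass.map_star, hg, Matrix.one_apply,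
      apply_ite (univSeminorm _ (unitaryRel_bounded N)).toCompl]
  · rw [← h0 _ (Or.inl ⟨i, j, Or.inr (Or.inr (Or.inr rfl))⟩)]
    simp [Matrix.mul_apply, StarHomClass.map_star, hg, Matrix.one_apply,
      apply_ite (univSeminorm _ (unitaryRel_bounded N)).toCompl]

theorem unitaryCoord_commute (N : ℕ) : ∀ y ∈ projCoords (entries (unitaryCoord N)),
    ∀ z ∈ projCoords (entries (unitaryCoord N)), y * z = z * y :=
  UnivCStar.projCoords_commute (unitaryRel_bounded N) Set.subset_union_right

theorem HalfSphere.exists_lift {x : Fin N → B} (h1 : ∑ i, x i * star (x i) = 1)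
    (h2 : ∑ i, star (x i) * x i = 1)
    (hc : ∀ y ∈ projCoords x, ∀ z ∈ projCoords x, y * z = z * y) :
    ∃ π : HalfSphere N →⋆ₐ[ℂ] B, ∀ i, π (sphereCoord N i) = x i := by
  refine UnivCStar.exists_lift (sphereRel_bounded N) x ?_
  rintro r ((rfl | rfl) | hr)
  · simp [StarHomClass.map_star, FreeStarAlg.lift_gen, h1]
  · simp [StarHomClass.map_star, FreeStarAlg.lift_gen, h2]
  · exact FreeStarAlg.lift_halfClassicalRel hc r hr

theorem sum_sphereCoord_mul_star (N : ℕ) : ∑ i, sphereCoord N i * star (sphereCoord N i) = 1 := by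
  have h := UnivCStar.toCompl_eq_zero (sphereRel_bounded N) (Or.inl (Or.inl rfl))
  rw [map_sub, map_sum, map_one, sub_eq_zero] at h
  simp only [map_mul, StarHomClass.map_star] at h
  exact h

theorem sum_star_sphereCoord_mul (N : ℕ) : ∑ i, star (sphereCoord N i) * sphereCoord N i = 1 := by
  have h := UnivCStar.toCompl_eq_zero (sphereRel_bounded N) (Or.inl (Or.inr rfl))
  rw [map_sub, map_sum, map_one, sub_eq_zero] at h
  simp only [map_mul, StarHomClass.map_star] at h
  exact h

theorem sphereCoord_commute (N : ℕ) :
    ∀ y ∈ projCoords (sphereCoord N), ∀ z ∈ projCoords (sphereCoord N), y * z = z * y :=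
  UnivCStar.projCoords_commute (sphereRel_bounded N) Set.subset_union_right

/-- The coordinates of the half-classical sphere half-commute: `a b* c (d* d) = c b* (d d*) a` for
all coordinates `d`, and both sums over `d` are equal to `1`. -/
theorem sphereCoord_half_commute (N : ℕ) (i j k : Fin N) :
    sphereCoord N i * star (sphereCoord N j) * sphereCoord N k =
      sphereCoord N k * star (sphereCoord N j) * sphereCoord N i := by
  set x := sphereCoord N
  have h1 : ∀ i j k l, x i * star (x j) * (x k * star (x l)) =
      x k * star (x l) * (x i * star (x j)) := fun i j k l =>
    sphereCoord_commute N _ ⟨i, j, Or.inl rfl⟩ _ ⟨k, l, Or.inl rfl⟩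
  have h2 : ∀ i j k l, star (x i) * x j * (star (x k) * x l) =
      star (x k) * x l * (star (x i) * x j) := fun i j k l =>
    sphereCoord_commute N _ ⟨i, j, Or.inr rfl⟩ _ ⟨k, l, Or.inr rfl⟩
  calc x i * star (x j) * x k
      = ∑ l, x i * star (x j) * (x k * star (x l)) * x l := by
        simp_rw [mul_assoc, ← Finset.mul_sum]
        rw [sum_star_sphereCoord_mul, mul_one]
    _ = ∑ l, x k * (star (x j) * x l * (star (x l) * x i)) := by
        refine Finset.sum_congr rfl fun l _ => ?_
        rw [h1, ← h2]
        simp only [mul_assoc]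
    _ = x k * star (x j) * x i := by
        simp_rw [mul_assoc, ← mul_assoc (x _) (star (x _)), ← Finset.mul_sum, ← Finset.sum_mul]
        rw [sum_sphereCoord_mul_star, one_mul]

end Relations

/-! ### Relations for products of commuting families -/

section CommutingProducts

variable {R : Type*} [Ring R] [StarRing R]

/-- Let the `m α` commute with the `p β` and with their adjoints. If the elements `ab*` and `a*b`
commute for the family `m`, and also for the family `p`, then they commute for a family of sums of
products `m α * p β`. -/
theorem projCoords_sum_mul_commute {α β ι κ : Type*} [Fintype κ] {m : α → R} {p : β → R}
    (h : ∀ a b, Commute (m a) (p b)) (h' : ∀ a b, Commute (m a) (star (p b)))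
    (hm : ∀ y ∈ projCoords m, ∀ z ∈ projCoords m, y * z = z * y)
    (hp : ∀ y ∈ projCoords p, ∀ z ∈ projCoords p, y * z = z * y)
    {x : ι → R} {f : ι → κ → α} {g : ι → κ → β} (hx : ∀ i, x i = ∑ k, m (f i k) * p (g i k)) :
    ∀ y ∈ projCoords x, ∀ z ∈ projCoords x, y * z = z * y := by
  have h1 : ∀ a b, Commute (star (m a)) (p b) := fun a b => by simpa using (h' a b).star_star
  have h2 : ∀ a b, Commute (star (m a)) (star (p b)) := fun a b => (h a b).star_star
  have hmp : ∀ y ∈ projCoords m, ∀ z ∈ projCoords p, Commute y z := by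
    rintro _ ⟨a, b, rfl | rfl⟩ _ ⟨c, d, rfl | rfl⟩
    · exact ((h a c).mul_right (h' a d)).mul_left ((h1 b c).mul_right (h2 b d))
    · exact ((h' a c).mul_right (h a d)).mul_left ((h2 b c).mul_right (h1 b d))
    · exact ((h1 a c).mul_right (h2 a d)).mul_left ((h b c).mul_right (h' b d))
    · exact ((h2 a c).mul_right (h1 a d)).mul_left ((h' b c).mul_right (h b d))
  have key : ∀ y ∈ projCoords x, ∃ s t : κ → κ → R, (∀ k l, s k l ∈ projCoords m) ∧
      (∀ k l, t k l ∈ projCoords p) ∧ y = ∑ k, ∑ l, s k l * t k l := by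
    rintro _ ⟨i, j, rfl | rfl⟩
    · refine ⟨fun k l => m (f i k) * star (m (f j l)), fun k l => p (g i k) * star (p (g j l)),
        fun k l => ⟨_, _, Or.inl rfl⟩, fun k l => ⟨_, _, Or.inl rfl⟩, ?_⟩
      simp only [hx, star_sum, star_mul, Finset.sum_mul_sum]
      refine Finset.sum_congr rfl fun k _ => Finset.sum_congr rfl fun l _ => ?_
      rw [mul_assoc, mul_assoc, ← mul_assoc (p _), ← ((h1 _ _).mul_right (h2 _ _)).eq]
    · refine ⟨fun k l => star (m (f i k)) * m (f j l), fun k l => star (p (g i k)) * p (g j l),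
        fun k l => ⟨_, _, Or.inr rfl⟩, fun k l => ⟨_, _, Or.inr rfl⟩, ?_⟩
      simp only [hx, star_sum, star_mul, Finset.sum_mul_sum]
      refine Finset.sum_congr rfl fun k _ => Finset.sum_congr rfl fun l _ => ?_
      rw [← (h2 _ _).eq, mul_assoc, mul_assoc, ← mul_assoc (star (p _)), ← (h' _ _).eq, mul_assoc]
  intro y hy z hz
  obtain ⟨s, t, hs, ht, rfl⟩ := key y hy
  obtain ⟨s', t', hs', ht', rfl⟩ := key z hz
  refine (Commute.sum_left _ _ _ fun k _ => Commute.sum_left _ _ _ fun l _ =>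
    Commute.sum_right _ _ _ fun k' _ => Commute.sum_right _ _ _ fun l' _ => ?_).eq
  exact (Commute.mul_right (hm _ (hs k l) _ (hs' k' l')) (hmp _ (hs k l) _ (ht' k' l'))).mul_left
    (Commute.mul_right (hmp _ (hs' k' l') _ (ht k l)).symm (hp _ (ht k l) _ (ht' k' l')))

variable {n κ : Type*} [Fintype n] {M : Matrix n n R} {P : Matrix n κ R}

omit [StarRing R] in
theorem Matrix.transpose_mul_of_commute (h : ∀ i j k l, Commute (M i j) (P k l)) :
    (M * P).transpose = P.transpose * M.transpose := by
  refine Matrix.ext fun i j => ?_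
  simp only [Matrix.transpose_apply, Matrix.mul_apply]
  exact Finset.sum_congr rfl fun k _ => (h j k k i).eq

theorem Matrix.map_star_mul_of_commute (h : ∀ i j k l, Commute (M i j) (P k l)) :
    (M * P).map star = M.map star * P.map star := by
  refine Matrix.ext fun i j => ?_
  simp only [Matrix.map_apply, Matrix.mul_apply, star_sum, star_mul]
  exact Finset.sum_congr rfl fun k _ => (h i k k j).star_star.eq.symm

theorem IsBiunitary.mul {N : ℕ} {M P : Matrix (Fin N) (Fin N) R} (hM : IsBiunitary M)
    (hP : IsBiunitary P) (h : ∀ i j k l, Commute (M i j) (P k l)) : IsBiunitary (M * P) where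
  mul_star := by
    rw [Matrix.conjTranspose_mul, Matrix.mul_assoc, ← Matrix.mul_assoc P, hP.mul_star,
      Matrix.one_mul, hM.mul_star]
  star_mul := by
    rw [Matrix.conjTranspose_mul, Matrix.mul_assoc, ← Matrix.mul_assoc _ M, hM.star_mul,
      Matrix.one_mul, hP.star_mul]
  transpose_mul := by
    rw [Matrix.transpose_mul_of_commute h, Matrix.map_star_mul_of_commute h, Matrix.mul_assoc,
      ← Matrix.mul_assoc _ (M.map star), hM.transpose_mul, Matrix.one_mul, hP.transpose_mul]
  mul_transpose := by
    rw [Matrix.transpose_mul_of_commute h, Matrix.map_star_mul_of_commute h, Matrix.mul_assoc,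
      ← Matrix.mul_assoc (P.map star), hP.mul_transpose, Matrix.one_mul, hM.mul_transpose]

theorem IsBiunitary.map {N : ℕ} {R' F : Type*} [Ring R'] [StarRing R'] [FunLike F R R']
    [RingHomClass F R R'] [StarHomClass F R R'] {M : Matrix (Fin N) (Fin N) R}
    (hM : IsBiunitary M) (f : F) : IsBiunitary (M.map f) := by
  have h1 : (M.map f).conjTranspose = M.conjTranspose.map f :=
    Matrix.ext fun i j => (StarHomClass.map_star f (M j i)).symm
  have h2 : (M.map f).map star = (M.map star).map f :=
    Matrix.ext fun i j => (StarHomClass.map_star f (M i j)).symm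
  have h3 : (M.map f).transpose = M.transpose.map f := rfl
  refine ⟨?_, ?_, ?_, ?_⟩
  · rw [h1, ← Matrix.map_mul, hM.mul_star, Matrix.map_one _ (map_zero f) (map_one f)]
  · rw [h1, ← Matrix.map_mul, hM.star_mul, Matrix.map_one _ (map_zero f) (map_one f)]
  · rw [h2, h3, ← Matrix.map_mul, hM.transpose_mul, Matrix.map_one _ (map_zero f) (map_one f)]
  · rw [h2, h3, ← Matrix.map_mul, hM.mul_transpose, Matrix.map_one _ (map_zero f) (map_one f)]

/-- The formula `uᵢⱼ ↦ uⱼᵢ*` for the antipode preserves the unitarity relations, when read in the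
opposite algebra. -/
theorem IsBiunitary.op_star {N : ℕ} {u : Matrix (Fin N) (Fin N) R} (hu : IsBiunitary u) :
    IsBiunitary (Matrix.of fun i j => MulOpposite.op (star (u j i))) := by
  have key : ∀ {X Y : Matrix (Fin N) (Fin N) R} {V W : Matrix (Fin N) (Fin N) Rᵐᵒᵖ}, X * Y = 1 →
      (∀ i j k, V i k * W k j = MulOpposite.op (X j k * Y k i)) → V * W = 1 := by
    intro X Y V W h hVW
    refine Matrix.ext fun i j => ?_
    simp only [Matrix.mul_apply, hVW, ← Finset.op_sum]
    rw [← Matrix.mul_apply, h, Matrix.one_apply, Matrix.one_apply, apply_ite MulOpposite.op]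
    simp only [eq_comm, MulOpposite.op_one, MulOpposite.op_zero]
  exact ⟨key hu.transpose_mul fun i j k => by simp, key hu.mul_transpose fun i j k => by simp,
    key hu.mul_star fun i j k => by simp, key hu.star_mul fun i j k => by simp⟩

theorem projCoords_op_star_commute {ι : Type*} {x : ι → R} {e : ι → ι}
    (hx : ∀ a ∈ projCoords x, ∀ b ∈ projCoords x, a * b = b * a) :
    ∀ a ∈ projCoords (fun i => MulOpposite.op (star (x (e i)))),
      ∀ b ∈ projCoords (fun i => MulOpposite.op (star (x (e i)))), a * b = b * a := by
  have h : ∀ a ∈ projCoords (fun i => MulOpposite.op (star (x (e i)))),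
      ∃ b ∈ projCoords x, a = MulOpposite.op b := by
    rintro _ ⟨i, j, rfl | rfl⟩
    · exact ⟨_, ⟨e j, e i, Or.inl rfl⟩, by simp⟩
    · exact ⟨_, ⟨e j, e i, Or.inr rfl⟩, by simp⟩
  intro a ha b hb
  obtain ⟨a', ha', rfl⟩ := h a ha
  obtain ⟨b', hb', rfl⟩ := h b hb
  rw [← MulOpposite.op_mul, ← MulOpposite.op_mul, hx a' ha' b' hb']

end CommutingProducts

/-! ### The two factors of the minimal tensor product -/

section MinTensorEmbeddings

variable {A B : Type*} [CStarAlgebra A] [CStarAlgebra B]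

variable (A B) in
/-- The embedding `a ↦ a ⊗ 1`. -/
noncomputable def MinTensor.inl : A →⋆ₐ[ℂ] MinTensor A B :=
  (minSeminorm A B).toCompl.comp
    { (Algebra.TensorProduct.includeLeft : A →ₐ[ℂ] A ⊗[ℂ] B) with
      map_star' := fun a => by
        change star a ⊗ₜ[ℂ] (1 : B) = star (a ⊗ₜ[ℂ] (1 : B))
        rw [TensorProduct.star_tmul, star_one] }

variable (A B) in
/-- The embedding `b ↦ 1 ⊗ b`. -/
noncomputable def MinTensor.inr : B →⋆ₐ[ℂ] MinTensor A B :=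
  (minSeminorm A B).toCompl.comp
    { (Algebra.TensorProduct.includeRight : B →ₐ[ℂ] A ⊗[ℂ] B) with
      map_star' := fun b => by
        change (1 : A) ⊗ₜ[ℂ] star b = star ((1 : A) ⊗ₜ[ℂ] b)
        rw [TensorProduct.star_tmul, star_one] }

theorem MinTensor.inl_mul_inr (a : A) (b : B) :
    MinTensor.inl A B a * MinTensor.inr A B b = MinTensor.tmul a b := by
  change (minSeminorm A B).toCompl (a ⊗ₜ 1) * (minSeminorm A B).toCompl (1 ⊗ₜ b) =
    (minSeminorm A B).toCompl (a ⊗ₜ b)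
  rw [← map_mul, Algebra.TensorProduct.tmul_mul_tmul, mul_one, one_mul]

theorem MinTensor.commute_inl_inr (a : A) (b : B) :
    Commute (MinTensor.inl A B a) (MinTensor.inr A B b) := by
  change (minSeminorm A B).toCompl (a ⊗ₜ 1) * (minSeminorm A B).toCompl (1 ⊗ₜ b) =
    (minSeminorm A B).toCompl (1 ⊗ₜ b) * (minSeminorm A B).toCompl (a ⊗ₜ 1)
  simp only [← map_mul, Algebra.TensorProduct.tmul_mul_tmul, mul_one, one_mul]

theorem MinTensor.tmul_mul_star_tmul (a a' : A) (b b' : B) :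
    MinTensor.tmul a b * star (MinTensor.tmul a' b') =
      MinTensor.tmul (a * star a') (b * star b') := by
  simp only [MinTensor.tmul, ← StarHomClass.map_star, ← map_mul, TensorProduct.star_tmul,
    Algebra.TensorProduct.tmul_mul_tmul]

theorem MinTensor.star_tmul_mul_tmul (a a' : A) (b b' : B) :
    star (MinTensor.tmul a b) * MinTensor.tmul a' b' =
      MinTensor.tmul (star a * a') (star b * b') := by
  simp only [MinTensor.tmul, ← StarHomClass.map_star, ← map_mul, TensorProduct.star_tmul,
    Algebra.TensorProduct.tmul_mul_tmul]

theorem MinTensor.projCoords_commute {α β ι κ : Type*} [Fintype κ] {m : α → A} {p : β → B}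
    (hm : ∀ y ∈ projCoords m, ∀ z ∈ projCoords m, y * z = z * y)
    (hp : ∀ y ∈ projCoords p, ∀ z ∈ projCoords p, y * z = z * y)
    {x : ι → MinTensor A B} (f : ι → κ → α) (g : ι → κ → β)
    (hx : ∀ i, x i = ∑ k, MinTensor.tmul (m (f i k)) (p (g i k))) :
    ∀ y ∈ projCoords x, ∀ z ∈ projCoords x, y * z = z * y := by
  refine projCoords_sum_mul_commute (m := fun a => MinTensor.inl A B (m a))
    (p := fun b => MinTensor.inr A B (p b)) (f := f) (g := g)
    (fun a b => MinTensor.commute_inl_inr _ _)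
    (fun a b => by rw [← StarHomClass.map_star]; exact MinTensor.commute_inl_inr _ _) ?_ ?_
    (fun i => by simp only [hx, MinTensor.inl_mul_inr])
  · rw [projCoords_comp]
    rintro _ ⟨y, hy, rfl⟩ _ ⟨z, hz, rfl⟩
    rw [← map_mul, hm y hy z hz, map_mul]
  · rw [projCoords_comp]
    rintro _ ⟨y, hy, rfl⟩ _ ⟨z, hz, rfl⟩
    rw [← map_mul, hp y hy z hz, map_mul]

theorem IsBiunitary.tensor {N : ℕ} {u : Matrix (Fin N) (Fin N) A} {v : Matrix (Fin N) (Fin N) B}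
    (hu : IsBiunitary u) (hv : IsBiunitary v) :
    IsBiunitary (Matrix.of fun i j => ∑ k, MinTensor.tmul (u i k) (v k j)) := by
  have h : u.map (MinTensor.inl A B) * v.map (MinTensor.inr A B) =
      Matrix.of fun i j => ∑ k, MinTensor.tmul (u i k) (v k j) := by
    refine Matrix.ext fun i j => ?_
    simp only [Matrix.mul_apply, Matrix.map_apply, MinTensor.inl_mul_inr, Matrix.of_apply]
  rw [← h]
  exact (hu.map _).mul (hv.map _) fun i j k l => MinTensor.commute_inl_inr _ _

theorem MinTensor.projCoords_entries_commute {N : ℕ} {u : Matrix (Fin N) (Fin N) A}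
    {v : Matrix (Fin N) (Fin N) B}
    (hu : ∀ y ∈ projCoords (entries u), ∀ z ∈ projCoords (entries u), y * z = z * y)
    (hv : ∀ y ∈ projCoords (entries v), ∀ z ∈ projCoords (entries v), y * z = z * y)
    {w : Matrix (Fin N) (Fin N) (MinTensor A B)}
    (hw : ∀ i j, w i j = ∑ k, MinTensor.tmul (u i k) (v k j)) :
    ∀ y ∈ projCoords (entries w), ∀ z ∈ projCoords (entries w), y * z = z * y :=
  MinTensor.projCoords_commute hu hv (fun s k => (s.1, k)) (fun s k => (k, s.2))
    fun s => hw s.1 s.2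

theorem HalfUnitary.exists_lift_tensor {N : ℕ} {u : Matrix (Fin N) (Fin N) A}
    {v : Matrix (Fin N) (Fin N) B} (hu : IsBiunitary u) (hv : IsBiunitary v)
    (hu' : ∀ y ∈ projCoords (entries u), ∀ z ∈ projCoords (entries u), y * z = z * y)
    (hv' : ∀ y ∈ projCoords (entries v), ∀ z ∈ projCoords (entries v), y * z = z * y) :
    ∃ Δ : HalfUnitary N →⋆ₐ[ℂ] MinTensor A B,
      ∀ i j, Δ (unitaryCoord N i j) = ∑ k, MinTensor.tmul (u i k) (v k j) :=
  HalfUnitary.exists_lift (hu.tensor hv) (MinTensor.projCoords_entries_commute hu' hv' fun _ _ => rfl)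

end MinTensorEmbeddings

/-! ### The half-classical unitary group and its action on the sphere -/

section HalfUnitaryGroup

variable (N : ℕ)

theorem unitaryCoord_comul : ∃ Δ : HalfUnitary N →⋆ₐ[ℂ] MinTensor (HalfUnitary N) (HalfUnitary N),
    ∀ i j, Δ (unitaryCoord N i j) =
      ∑ k, MinTensor.tmul (unitaryCoord N i k) (unitaryCoord N k j) :=
  HalfUnitary.exists_lift_tensor (unitaryCoord_isBiunitary N) (unitaryCoord_isBiunitary N)
    (unitaryCoord_commute N) (unitaryCoord_commute N)

theorem unitaryCoord_counit : ∃ ε : HalfUnitary N →⋆ₐ[ℂ] ℂ,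
    ∀ i j, ε (unitaryCoord N i j) = if i = j then 1 else 0 :=
  HalfUnitary.exists_lift (v := (1 : Matrix (Fin N) (Fin N) ℂ))
    ⟨by simp, by simp, by simp, by simp⟩ fun y _ z _ => mul_comm y z

theorem unitaryCoord_antipode : ∃ S : HalfUnitary N →⋆ₐ[ℂ] (HalfUnitary N)ᵐᵒᵖ,
    ∀ i j, S (unitaryCoord N i j) = MulOpposite.op (star (unitaryCoord N j i)) :=
  HalfUnitary.exists_lift (unitaryCoord_isBiunitary N).op_star
    (projCoords_op_star_commute (e := Prod.swap) (unitaryCoord_commute N))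

theorem isClosedSubgroup_unitaryCoord : IsClosedSubgroup (unitaryCoord N) := by
  have hu := unitaryCoord_isBiunitary N
  refine ⟨hu.mul_star, hu.star_mul, hu.transpose_mul, hu.mul_transpose,
    UnivCStar.polyAlg_gen_dense (unitaryRel_bounded N), unitaryCoord_comul N, ?_, ?_⟩
  · obtain ⟨ε, hε⟩ := unitaryCoord_counit N
    exact ⟨ε.comp (polyAlg (entries (unitaryCoord N))).subtype, hε⟩
  · obtain ⟨S, hS⟩ := unitaryCoord_antipode N
    have hmem : ∀ a ∈ polyAlg (entries (unitaryCoord N)),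
        (S a).unop ∈ polyAlg (entries (unitaryCoord N)) := by
      intro a ha
      induction ha using StarAlgebra.adjoin_induction with
      | mem x hx =>
        obtain ⟨⟨i, j⟩, rfl⟩ := hx
        change (S (unitaryCoord N i j)).unop ∈ _
        rw [hS]
        exact star_mem (coord_mem_polyAlg (entries (unitaryCoord N)) (j, i))
      | algebraMap c => rw [AlgHomClass.commutes]; exact algebraMap_mem _ c
      | add x y _ _ hx hy => rw [map_add]; exact add_mem hx hy
      | mul x y _ _ hx hy => rw [map_mul]; exact mul_mem hy hx
      | star x _ hx => rw [StarHomClass.map_star]; exact star_mem hx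
    refine ⟨{ toFun := fun a => MulOpposite.op ⟨(S a).unop, hmem a a.2⟩
              map_one' := ?_, map_mul' := ?_, map_zero' := ?_, map_add' := ?_
              commutes' := ?_, map_star' := ?_ }, ?_⟩
    · exact MulOpposite.unop_injective (Subtype.ext (by simp))
    · exact fun a b => MulOpposite.unop_injective (Subtype.ext (by simp))
    · exact MulOpposite.unop_injective (Subtype.ext (by simp))
    · exact fun a b => MulOpposite.unop_injective (Subtype.ext (by simp))
    · exact fun c => MulOpposite.unop_injective (Subtype.ext
        (congrArg MulOpposite.unop (AlgHomClass.commutes S c)))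
    · exact fun a => MulOpposite.unop_injective (Subtype.ext
        (congrArg MulOpposite.unop (StarHomClass.map_star S (a : HalfUnitary N))))
    · exact fun i j => MulOpposite.unop_injective (Subtype.ext
        (congrArg MulOpposite.unop (hS i j)))

theorem affineAction_unitaryCoord : AffineAction (unitaryCoord N) (sphereCoord N) := by
  have hu := (unitaryCoord_isBiunitary N).map (MinTensor.inl _ (HalfSphere N))
  set M := (unitaryCoord N).map (MinTensor.inl _ (HalfSphere N))
  let P : Matrix (Fin N) Unit (MinTensor (HalfUnitary N) (HalfSphere N)) :=
    fun j _ => MinTensor.inr (HalfUnitary N) _ (sphereCoord N j)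
  have hc : ∀ i j k l, Commute (M i j) (P k l) := fun i j k l => MinTensor.commute_inl_inr _ _
  have hMP : ∀ i, (M * P) i () = ∑ j, MinTensor.tmul (unitaryCoord N i j) (sphereCoord N j) := by
    intro i
    rw [Matrix.mul_apply]
    exact Finset.sum_congr rfl fun j _ => MinTensor.inl_mul_inr _ _
  refine HalfSphere.exists_lift
    (x := fun i => ∑ j, MinTensor.tmul (unitaryCoord N i j) (sphereCoord N j)) ?_ ?_ ?_
  · have h1 : (M * P).transpose * (M * P).map star = P.transpose * P.map star := by
      rw [Matrix.transpose_mul_of_commute hc, Matrix.map_star_mul_of_commute hc, Matrix.mul_assoc,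
        ← Matrix.mul_assoc _ (M.map star), hu.transpose_mul, Matrix.one_mul]
    have h2 := congrFun₂ h1 () ()
    simp only [Matrix.mul_apply (M := (M * P).transpose), Matrix.mul_apply (M := P.transpose),
      Matrix.transpose_apply, Matrix.map_apply, hMP] at h2
    rw [h2, ← map_one (MinTensor.inr (HalfUnitary N) (HalfSphere N)),
      ← sum_sphereCoord_mul_star N, map_sum]
    simp only [P, map_mul, StarHomClass.map_star]
  · have h1 : (M * P).conjTranspose * (M * P) = P.conjTranspose * P := by
      rw [Matrix.conjTranspose_mul, Matrix.mul_assoc, ← Matrix.mul_assoc _ M, hu.star_mul,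
        Matrix.one_mul]
    have h2 := congrFun₂ h1 () ()
    simp only [Matrix.mul_apply (M := (M * P).conjTranspose),
      Matrix.mul_apply (M := P.conjTranspose), Matrix.conjTranspose_apply, hMP] at h2
    rw [h2, ← map_one (MinTensor.inr (HalfUnitary N) (HalfSphere N)),
      ← sum_star_sphereCoord_mul N, map_sum]
    simp only [P, map_mul, StarHomClass.map_star]
  · exact MinTensor.projCoords_commute (unitaryCoord_commute N) (sphereCoord_commute N)
      (fun i k => (i, k)) (fun _ k => k) fun _ => rfl

end HalfUnitaryGroup

/-! ### Actions force the half-classical relations -/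

section ProjectiveActions

variable {N : ℕ} {A A' B : Type*} [CStarAlgebra A] [CStarAlgebra A'] [CStarAlgebra B]

/-- `p` and `q`, which play the role of the `xᵢ xⱼ*` and the `xᵢ* xⱼ`, have enough values: for all
unit vectors `z` and `w`, a positive functional evaluates quadratic monomials in `p` and `q` at the
point where `pᵢⱼ = zᵢ z̄ⱼ` and `qᵢⱼ = w̄ᵢ wⱼ`. -/
def HasPointEvaluations (p q : Fin N → Fin N → B) : Prop :=
  ∀ z w : Fin N → ℂ, ∑ a, z a * star (z a) = 1 → ∑ a, w a * star (w a) = 1 →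
    ∃ g : B →ₗ[ℂ] ℂ, (∀ b, 0 ≤ g (star b * b)) ∧
      (∀ a b c d, g (p a b * p c d) = z a * star (z b) * (z c * star (z d))) ∧
      (∀ a b c d, g (p a b * q c d) = z a * star (z b) * (star (w c) * w d)) ∧
      ∀ a b c d, g (q c d * p a b) = star (w c) * w d * (z a * star (z b))

theorem map_slice_mul {κ κ' : Type*} [Fintype κ] [Fintype κ'] (ι : A' →⋆ₐ[ℂ] A) {g : B →ₗ[ℂ] ℂ}
    {m : κ → A'} {m' : κ' → A'} {p : κ → B} {p' : κ' → B} {α : κ → ℂ} {β : κ' → ℂ}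
    (hg : ∀ x y, g (p x * p' y) = α x * β y) :
    ι (slice A' g ((∑ x, m x ⊗ₜ[ℂ] p x) * ∑ y, m' y ⊗ₜ[ℂ] p' y)) =
      (∑ x, α x • ι (m x)) * ∑ y, β y • ι (m' y) := by
  simp only [Finset.sum_mul_sum, map_sum, Algebra.TensorProduct.tmul_mul_tmul, slice_tmul, hg,
    map_smul, map_mul, smul_mul_smul_comm]

/-- If the elements `Pᵢⱼ = ∑ uᵢₐ uⱼᵦ* ⊗ pₐᵦ` and `Qᵢⱼ = ∑ uᵢₐ* uⱼᵦ ⊗ qₐᵦ` satisfy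
`Pᵢⱼ Pₖₗ = Pₖⱼ Pᵢₗ` and `Pᵢⱼ Qₖₗ = Qₖₗ Pᵢⱼ`, then `u` satisfies the commutation relations of `U_N*`:
slicing by point evaluations gives relations between the `uᵢ(z) uⱼ(z)*` and `uₖ(w)* uₗ(w)`. The
coefficients `m` and `s` may lie in a smaller algebra `A'` that is mapped to `A` by `ι`. -/
theorem IsClosedSubgroup.commute_of_action {u : Matrix (Fin N) (Fin N) A} (hu : IsClosedSubgroup u)
    (ι : A' →⋆ₐ[ℂ] A) {m s : Fin N × Fin N → Fin N × Fin N → A'}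
    (hm : ∀ x y, ι (m x y) = entries u x * star (entries u y))
    (hs : ∀ x y, ι (s x y) = star (entries u x) * entries u y)
    {p q : Fin N → Fin N → B} (hpq : HasPointEvaluations p q)
    {P Q : Fin N → Fin N → MinTensor A' B}
    (hP : ∀ i j, P i j = ∑ a, ∑ b, MinTensor.tmul (m (i, a) (j, b)) (p a b))
    (hQ : ∀ i j, Q i j = ∑ a, ∑ b, MinTensor.tmul (s (i, a) (j, b)) (q a b))
    (h1 : ∀ i j k l, P i j * P k l = P k j * P i l)
    (h2 : ∀ i j k l, P i j * Q k l = Q k l * P i j) :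
    ∀ y ∈ projCoords (entries u), ∀ z ∈ projCoords (entries u), y * z = z * y := by
  let Pt : Fin N → Fin N → A' ⊗[ℂ] B := fun i j =>
    ∑ x : Fin N × Fin N, m (i, x.1) (j, x.2) ⊗ₜ[ℂ] p x.1 x.2
  let Qt : Fin N → Fin N → A' ⊗[ℂ] B := fun i j =>
    ∑ x : Fin N × Fin N, s (i, x.1) (j, x.2) ⊗ₜ[ℂ] q x.1 x.2
  have hPt : ∀ i j, P i j = (minSeminorm A' B).toCompl (Pt i j) := fun i j => by
    rw [hP, map_sum, Fintype.sum_prod_type]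
    rfl
  have hQt : ∀ i j, Q i j = (minSeminorm A' B).toCompl (Qt i j) := fun i j => by
    rw [hQ, map_sum, Fintype.sum_prod_type]
    rfl
  have hz : ∀ (z : Fin N → ℂ) i j, rowComb u i z * star (rowComb u j z) =
      ∑ x : Fin N × Fin N, (z x.1 * star (z x.2)) • ι (m (i, x.1) (j, x.2)) := fun z i j => by
    rw [rowComb_mul_star, Fintype.sum_prod_type]
    simp only [hm]
    rfl
  have hw : ∀ (w : Fin N → ℂ) i j, star (rowComb u i w) * rowComb u j w =
      ∑ x : Fin N × Fin N, (star (w x.1) * w x.2) • ι (s (i, x.1) (j, x.2)) := fun w i j => by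
    rw [star_rowComb_mul, Fintype.sum_prod_type]
    simp only [hs]
    rfl
  -- an equality in the minimal tensor product of elements of the algebraic one may be sliced
  have hslice : ∀ {t t' : A' ⊗[ℂ] B}, (minSeminorm A' B).toCompl t = (minSeminorm A' B).toCompl t' →
      ∀ {g : B →ₗ[ℂ] ℂ}, (∀ b, 0 ≤ g (star b * b)) → ι (slice A' g t) = ι (slice A' g t') := by
    intro t t' htt g hg
    have h := slice_eq_zero (t := t - t') (by rw [map_sub, htt, sub_self]) hg
    rw [map_sub, sub_eq_zero] at h
    rw [h]
  refine hu.projCoords_commute ?_ ?_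
  · intro z hz1 i j k l
    obtain ⟨g, hg, hg1, -⟩ := hpq z z hz1 hz1
    have h := h1 i j k l
    simp only [hPt, ← map_mul] at h
    have h' := hslice h hg
    rw [map_slice_mul ι fun x y => hg1 x.1 x.2 y.1 y.2,
      map_slice_mul ι fun x y => hg1 x.1 x.2 y.1 y.2] at h'
    simpa only [hz] using h'
  · intro z w hz1 hw1 i j k l
    obtain ⟨g, hg, -, hg2, hg3⟩ := hpq z w hz1 hw1
    have h := h2 i j k l
    simp only [hPt, hQt, ← map_mul] at h
    have h' := hslice h hg
    rw [map_slice_mul ι fun x y => hg2 x.1 x.2 y.1 y.2,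
      map_slice_mul ι fun y x => hg3 x.1 x.2 y.1 y.2] at h'
    simpa only [hz, hw] using h'

theorem IsClosedSubgroup.qIncl_of_action {u : Matrix (Fin N) (Fin N) A} (hu : IsClosedSubgroup u)
    {p q : Fin N → Fin N → B} (Φ : B →⋆ₐ[ℂ] MinTensor A' B)
    {m s : Fin N × Fin N → Fin N × Fin N → A'}
    (hp : ∀ i j, Φ (p i j) = ∑ a, ∑ b, MinTensor.tmul (m (i, a) (j, b)) (p a b))
    (hq : ∀ i j, Φ (q i j) = ∑ a, ∑ b, MinTensor.tmul (s (i, a) (j, b)) (q a b))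
    (ι : A' →⋆ₐ[ℂ] A) (hm : ∀ x y, ι (m x y) = entries u x * star (entries u y))
    (hs : ∀ x y, ι (s x y) = star (entries u x) * entries u y) (hpq : HasPointEvaluations p q)
    (h1 : ∀ i j k l, p i j * p k l = p k j * p i l)
    (h2 : ∀ i j k l, p i j * q k l = q k l * p i j) : QIncl u (unitaryCoord N) := by
  refine HalfUnitary.exists_lift hu.isBiunitary
    (hu.commute_of_action ι hm hs hpq hp hq (fun i j k l => ?_) fun i j k l => ?_)
  · rw [← map_mul, h1, map_mul]
  · rw [← map_mul, h2, map_mul]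

theorem IsClosedSubgroup.qIncl_of_fullProjAction {u : Matrix (Fin N) (Fin N) A}
    (hu : IsClosedSubgroup u) {p q : Fin N → Fin N → B} (hpq : HasPointEvaluations p q)
    (h1 : ∀ i j k l, p i j * p k l = p k j * p i l)
    (h2 : ∀ i j k l, p i j * q k l = q k l * p i j) (h : FullProjAction u p q) :
    QIncl u (unitaryCoord N) := by
  obtain ⟨Φ, hp, hq⟩ := h
  exact hu.qIncl_of_action Φ (m := projMulStar (entries u)) (s := projStarMul (entries u)) hp hq
    (projAlg (entries u)).subtype (fun _ _ => rfl) (fun _ _ => rfl) hpq h1 h2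

theorem IsClosedSubgroup.qIncl_of_affineAction {u : Matrix (Fin N) (Fin N) A}
    (hu : IsClosedSubgroup u) {x : Fin N → B}
    (hx : HasPointEvaluations (fun i j => x i * star (x j)) fun i j => star (x i) * x j)
    (h1 : ∀ i j k l, x i * star (x j) * (x k * star (x l)) =
      x k * star (x j) * (x i * star (x l)))
    (h2 : ∀ i j k l, x i * star (x j) * (star (x k) * x l) =
      star (x k) * x l * (x i * star (x j))) (h : AffineAction u x) :
    QIncl u (unitaryCoord N) := by
  obtain ⟨Φ, hΦ⟩ := h
  refine hu.qIncl_of_action Φ (m := fun x y => entries u x * star (entries u y))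
    (s := fun x y => star (entries u x) * entries u y) (fun i j => ?_) (fun i j => ?_)
    (StarAlgHom.id ℂ A) (fun _ _ => rfl) (fun _ _ => rfl) hx h1 h2
  · simp only [map_mul, StarHomClass.map_star, hΦ, star_sum, Finset.sum_mul_sum,
      MinTensor.tmul_mul_star_tmul]
    rfl
  · simp only [map_mul, StarHomClass.map_star, hΦ, star_sum, Finset.sum_mul_sum,
      MinTensor.star_tmul_mul_tmul]
    rfl

end ProjectiveActions

/-! ### Points of the projective spaces and of the half-classical sphere -/

section Models

variable {N : ℕ}

/-- The rank one projection on the line spanned by a unit vector. -/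
def ProjSpace.ofUnit (z : Fin N → ℂ) (hz : ∑ a, z a * star (z a) = 1) : ProjSpace N :=
  ⟨Matrix.vecMulVec z (star z), by
    have h : star z ⬝ᵥ z = 1 := by
      rw [dotProduct_comm]
      exact hz
    rw [Matrix.vecMulVec_mul_vecMulVec, h, one_smul], by
    rw [Matrix.conjTranspose_vecMulVec, star_star], hz⟩

theorem projProd_hasPointEvaluations (N : ℕ) :
    HasPointEvaluations (projProdLeft N) (projProdRight N) := by
  intro z w hz hw
  let x : ProjSpace N × ProjSpace N := (.ofUnit z hz, .ofUnit w hw)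
  refine ⟨{ toFun := fun f => f x, map_add' := fun _ _ => rfl, map_smul' := fun _ _ => rfl },
    fun b => ?_, fun a b c d => rfl, fun a b c d => ?_, fun a b c d => ?_⟩
  · exact star_mul_self_nonneg (b x)
  · change z a * star (z b) * (w d * star (w c)) = _
    ring
  · change (w d * star (w c)) * (z a * star (z b)) = _
    ring

/-- The entries of a rank one matrix satisfy `pᵢⱼ pₖₗ = pₖⱼ pᵢₗ`. -/
theorem projSpace_minor (p : ProjSpace N) (i j k l : Fin N) :
    p.1 i j * p.1 k l = p.1 k j * p.1 i l := by
  obtain ⟨p, h1, h2, h3⟩ := p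
  change p i j * p k l = p k j * p i l
  have hstar : ∀ a b, star (p a b) = p b a := fun a b => congrFun₂ h2 b a
  have hsq : ∀ a b, ∑ c, p a c * p c b = p a b := fun a b => congrFun₂ h1 a b
  have htr : ∑ a, p a a = 1 := h3
  let m : Fin N → Fin N → Fin N → ℂ := fun k l j => p i j * p k l - p k j * p i l
  have hj : ∀ k l, ∑ j, star (m k l j) * m k l j = p i i * (p k l * p l k) -
      p k i * (p i l * p l k) - p i k * (p k l * p l i) + p k k * (p i l * p l i) := by
    intro k l
    simp only [← hsq i i, ← hsq k i, ← hsq i k, ← hsq k k, Finset.sum_mul,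
      ← Finset.sum_sub_distrib, ← Finset.sum_add_distrib]
    refine Finset.sum_congr rfl fun j _ => ?_
    simp only [m, star_sub, star_mul', hstar]
    ring
  have hl : ∀ k, ∑ l, ∑ j, star (m k l j) * m k l j =
      2 * (p i i * p k k - p i k * p k i) := by
    intro k
    simp only [hj, Finset.sum_add_distrib, Finset.sum_sub_distrib, ← Finset.mul_sum, hsq]
    ring
  -- the sum of the squares `|pᵢⱼ pₖₗ - pₖⱼ pᵢₗ|²` over `j`, `k`, `l` is `2 (pᵢᵢ tr p - (p²)ᵢᵢ) = 0`
  have hk : ∑ k, ∑ l, ∑ j, star (m k l j) * m k l j = 0 := by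
    simp only [hl, ← Finset.mul_sum, Finset.sum_sub_distrib, hsq, htr]
    ring
  have hnn : ∀ k l j, 0 ≤ star (m k l j) * m k l j := fun k l j => star_mul_self_nonneg _
  have e1 := (Finset.sum_eq_zero_iff_of_nonneg fun k _ => Finset.sum_nonneg fun l _ =>
    Finset.sum_nonneg fun j _ => hnn k l j).1 hk k (Finset.mem_univ k)
  have e2 := (Finset.sum_eq_zero_iff_of_nonneg fun l _ =>
    Finset.sum_nonneg fun j _ => hnn k l j).1 e1 l (Finset.mem_univ l)
  have e3 := (Finset.sum_eq_zero_iff_of_nonneg fun j _ => hnn k l j).1 e2 j (Finset.mem_univ j)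
  exact sub_eq_zero.1 (CStarRing.star_mul_self_eq_zero_iff _ |>.1 e3)

/-- For unit vectors `z` and `w`, the matrices with rows `(0, zᵢ)` and `(wᵢ, 0)` satisfy the
relations of the half-classical sphere; so this sphere has a representation on `ℂ²`. Its
first diagonal coefficient is evaluation at `(z, w)` on the algebra of the projective version. -/
theorem exists_sphere_rep {z w : Fin N → ℂ} (hz : ∑ a, z a * star (z a) = 1)
    (hw : ∑ a, w a * star (w a) = 1) :
    ∃ π : HalfSphere N →⋆ₐ[ℂ] CStarMatrix (Fin 2) (Fin 2) ℂ,
      ∀ i, π (sphereCoord N i) = CStarMatrix.ofMatrix !![0, z i; w i, 0] := by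
  have h1 : ∀ i j, CStarMatrix.ofMatrix !![0, z i; w i, 0] *
      star (CStarMatrix.ofMatrix !![0, z j; w j, 0]) =
      CStarMatrix.ofMatrix (Matrix.diagonal ![z i * star (z j), w i * star (w j)]) := by
    intro i j
    ext a b
    fin_cases a <;> fin_cases b <;>
      simp [CStarMatrix.mul_apply, CStarMatrix.star_apply, Fin.sum_univ_two]
  have h2 : ∀ i j, star (CStarMatrix.ofMatrix !![0, z i; w i, 0]) *
      CStarMatrix.ofMatrix !![0, z j; w j, 0] =
      CStarMatrix.ofMatrix (Matrix.diagonal ![star (w i) * w j, star (z i) * z j]) := by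
    intro i j
    ext a b
    fin_cases a <;> fin_cases b <;>
      simp [CStarMatrix.mul_apply, CStarMatrix.star_apply, Fin.sum_univ_two]
  have h3 : ∀ y ∈ projCoords (fun i => CStarMatrix.ofMatrix !![0, z i; w i, 0]),
      ∃ d, y = CStarMatrix.ofMatrix (Matrix.diagonal d) := by
    rintro _ ⟨i, j, rfl | rfl⟩
    · exact ⟨_, h1 i j⟩
    · exact ⟨_, h2 i j⟩
  refine HalfSphere.exists_lift (x := fun i => CStarMatrix.ofMatrix !![0, z i; w i, 0]) ?_ ?_ ?_
  · simp only [h1]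
    change ∑ i, Matrix.diagonal ![z i * star (z i), w i * star (w i)] = 1
    ext a b
    fin_cases a <;> fin_cases b <;> simp_all [Matrix.sum_apply]
  · simp only [h2]
    change ∑ i, Matrix.diagonal ![star (w i) * w i, star (z i) * z i] = 1
    ext a b
    fin_cases a <;> fin_cases b <;> simp_all [Matrix.sum_apply, mul_comm]
  · intro y hy y' hy'
    obtain ⟨d, rfl⟩ := h3 y hy
    obtain ⟨d', rfl⟩ := h3 y' hy'
    change Matrix.diagonal d * Matrix.diagonal d' = Matrix.diagonal d' * Matrix.diagonal d
    simp only [Matrix.diagonal_mul_diagonal, mul_comm]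

theorem sphere_hasPointEvaluations (N : ℕ) :
    HasPointEvaluations (fun i j => sphereCoord N i * star (sphereCoord N j))
      (fun i j => star (sphereCoord N i) * sphereCoord N j) := by
  intro z w hz hw
  obtain ⟨π, hπ⟩ := exists_sphere_rep hz hw
  refine ⟨{ toFun := fun f => π f 0 0, map_add' := fun x y => ?_, map_smul' := fun c x => ?_ },
    fun b => ?_, fun a b c d => ?_, fun a b c d => ?_, fun a b c d => ?_⟩
  · rw [map_add]; rfl
  · rw [map_smul]; rfl
  · change 0 ≤ π (star b * b) 0 0
    rw [map_mul, StarHomClass.map_star, CStarMatrix.mul_apply]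
    exact Finset.sum_nonneg fun k _ => star_mul_self_nonneg (π b k 0)
  all_goals
    simp [hπ, StarHomClass.map_star, CStarMatrix.mul_apply, CStarMatrix.star_apply,
      Fin.sum_univ_two]

theorem sphere_proj_hasPointEvaluations (N : ℕ) :
    HasPointEvaluations (projMulStar (sphereCoord N)) (projStarMul (sphereCoord N)) := by
  intro z w hz hw
  obtain ⟨g, hg, h⟩ := sphere_hasPointEvaluations N z w hz hw
  exact ⟨g ∘ₗ (projAlg (sphereCoord N)).subtype.toAlgHom.toLinearMap, fun b => hg b, h⟩

end Models

theorem proposition4p4 (N : ℕ) :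
    -- affine action of `U_N*` on the sphere
    (IsClosedSubgroup (unitaryCoord N) ∧ AffineAction (unitaryCoord N) (sphereCoord N)) ∧
    -- a full projective action on `P × P`, also in the form of `𝒫 S^{N-1}_{ℂ,*}`
    (∀ (A : Type w) [CStarAlgebra A] (u : Matrix (Fin N) (Fin N) A), IsClosedSubgroup u →
      (FullProjAction u (projProdLeft N) (projProdRight N) → QIncl u (unitaryCoord N)) ∧
      (FullProjAction u (projMulStar (sphereCoord N)) (projStarMul (sphereCoord N)) →
        QIncl u (unitaryCoord N))) ∧
    -- affine actions on the sphere
    (∀ (A : Type w) [CStarAlgebra A] (u : Matrix (Fin N) (Fin N) A), IsClosedSubgroup u →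
      AffineAction u (sphereCoord N) → QIncl u (unitaryCoord N)) ∧
    -- the quantum isometry group of the sphere
    IsQuantumIsometryGroup.{w} (unitaryCoord N) (sphereCoord N) := by
  have hminor : ∀ i j k l, sphereCoord N i * star (sphereCoord N j) *
      (sphereCoord N k * star (sphereCoord N l)) = sphereCoord N k * star (sphereCoord N j) *
      (sphereCoord N i * star (sphereCoord N l)) := fun i j k l => by
    rw [← mul_assoc, sphereCoord_half_commute, mul_assoc]
  have hcomm : ∀ i j k l, sphereCoord N i * star (sphereCoord N j) *
      (star (sphereCoord N k) * sphereCoord N l) = star (sphereCoord N k) * sphereCoord N l *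
      (sphereCoord N i * star (sphereCoord N j)) := fun i j k l =>
    sphereCoord_commute N _ ⟨i, j, Or.inl rfl⟩ _ ⟨k, l, Or.inr rfl⟩
  have haff : ∀ (A : Type w) [CStarAlgebra A] (u : Matrix (Fin N) (Fin N) A), IsClosedSubgroup u →
      AffineAction u (sphereCoord N) → QIncl u (unitaryCoord N) := fun A _ u hu =>
    hu.qIncl_of_affineAction (sphere_hasPointEvaluations N) hminor hcomm
  refine ⟨⟨isClosedSubgroup_unitaryCoord N, affineAction_unitaryCoord N⟩,
    fun A _ u hu => ⟨?_, ?_⟩, haff, isClosedSubgroup_unitaryCoord N, affineAction_unitaryCoord N,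
    haff⟩
  · exact hu.qIncl_of_fullProjAction (projProd_hasPointEvaluations N)
      (fun i j k l => ContinuousMap.ext fun x => projSpace_minor x.1 i j k l)
      fun i j k l => mul_comm _ _
  · exact hu.qIncl_of_fullProjAction (sphere_proj_hasPointEvaluations N)
      (fun i j k l => Subtype.ext (hminor i j k l)) fun i j k l => Subtype.ext (hcomm i j k l)
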